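/- Let $\mathfrak g$ be the two-dimensional complex Lie algebra with basis $\{a,b\}$ and $[a,b]=b$, and let $\mathfrak n=\langle b\rangle$. Let $\mathfrak W$ be the category of $\mathfrak g$-modules $M$ on which $\mathfrak n$ acts locally finitely, i.e. $\dim U(\mathfrak n)v<\infty$ for all $v\in M$ (Whittaker modules). Let $\sim$ be the smallest equivalence relation on isomorphism classes of simple finite-dimensional $\mathfrak n$-modules such that $L\sim S$ whenever $L$ and $S$ both occur as composition factors of some indecomposable finite-dimensional $\mathfrak n$-module, or $S$ is a subquotient of $(\mathfrak g/\mathfrak n)\otimes L$. Let $\mathfrak W(0)$ be the block of $\lambda=0$: the full subcategory of those $M\in\mathfrak W$ that are the sum of the images of all homomorphisms $U(\mathfrak g)\otimes_{U(\mathfrak n)}N\to M$, where $N$ runs over the finite-dimensional $\mathfrak n$-modules all of whose composition factors lie in the $\sim$-class of the trivial one-dimensional module. Let $\overline{\mathfrak W(0)}$ be the full subcategory of $\mathfrak W(0)$ of modules of finite length. For $\mu\in\mathbb C$ let $L(\mu)$ be the one-dimensional $\mathfrak g$-module on which $b$ acts by $0$ and $a$ by $\mu$. For $\xi\in\mathbb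 C/\mathbb Z$ let $\overline{\mathfrak W(0)}_\xi$ be the full subcategory of $\overline{\mathfrak W(0)}$ of modules all of whose simple subquotients are isomorphic to $L(\mu)$ with $\mu\in\xi$. Then: (i) $\overline{\mathfrak W(0)}\cong\bigoplus_{\xi\in\mathbb C/\mathbb Z}\overline{\mathfrak W(0)}_\xi$. That is, $(M_\xi)_\xi\mapsto\bigoplus_\xi M_\xi$ is an equivalence from the category of families of objects $M_\xi\in\overline{\mathfrak W(0)}_\xi$, almost all zero, to $\overline{\mathfrak W(0)}$. (ii) For each $\xi\in\mathbb C/\mathbb Z$, the category $\overline{\mathfrak W(0)}_\xi$ is equivalent, as a $\mathbb C$-linear category, to the category of finite-dimensional modules over the quiver with vertex set $\mathbb Z$, a loop $\mathtt a_i:i\to i$ and an arrow $\mathtt b_i:i\to i+1$ for every $i\in\mathbb Z$, with relations $\mathtt b_i\mathtt a_i=\mathtt a_{i+1}\mathtt b_i$ for all $i$, on which every $\mathtt a_i$ acts locally nilpotently. (Finite-dimensional means that the direct sum of the spaces at all vertices is finite dimensional.) -/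

import Mathlib

open CategoryTheory CategoryTheory.Limits
open scoped TensorProduct ModuleCat

universe u v w

namespace Whittaker

/-! ### Finite-dimensional modules over a complex Lie algebra -/

/-- A finite-dimensional module over the complex Lie algebra `L` (bundled). -/
structure FDLieMod (L : Type u) [LieRing L] [LieAlgebra ℂ L] where
  carrier : Type v
  [addCommGroup : AddCommGroup carrier]
  [module : Module ℂ carrier]
  [lieRingModule : LieRingModule L carrier]
  [lieModule : LieModule ℂ L carrier]
  [finite : Module.Finite ℂ carrier]

attribute [instance] FDLieMod.addCommGroup FDLieMod.module FDLieMod.lieRingModule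
  FDLieMod.lieModule FDLieMod.finite

section LieSide

variable {L : Type u} [LieRing L] [LieAlgebra ℂ L]

/-- `[M : S] ≠ 0`: the module `S` is isomorphic to a subquotient of `M`
(used for simple finite-dimensional `S`). -/
def HasFactor (M : Type v) [AddCommGroup M] [Module ℂ M] [LieRingModule L M] [LieModule ℂ L M]
    (S : Type w) [AddCommGroup S] [Module ℂ S] [LieRingModule L S] [LieModule ℂ L S] : Prop :=
  ∃ p q : LieSubmodule ℂ L M, p ≤ q ∧ Nonempty ((q ⧸ p.comap q.incl) ≃ₗ⁅ℂ,L⁆ S)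

/-- The module `M` is nonzero and is not a direct sum of two nonzero submodules. -/
def IsIndecomposable (M : Type v) [AddCommGroup M] [Module ℂ M] [LieRingModule L M]
    [LieModule ℂ L M] : Prop :=
  Nontrivial M ∧ ∀ p q : LieSubmodule ℂ L M, IsCompl p q → p = ⊥ ∨ q = ⊥

/-- `S` is the one-dimensional module on which `L` acts by the character `χ`. -/
def IsCharModule (χ : LieAlgebra.LieCharacter ℂ L) (S : Type v) [AddCommGroup S] [Module ℂ S]
    [LieRingModule L S] : Prop :=
  Module.finrank ℂ S = 1 ∧ ∀ (x : L) (s : S), ⁅x, s⁆ = χ x • s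

end LieSide

/-- Simple finite-dimensional modules over `L`. -/
abbrev IrrFD (L : Type u) [LieRing L] [LieAlgebra ℂ L] :=
  {S : FDLieMod.{u, v} L // LieModule.IsIrreducible ℂ L S.carrier}

section Blocks

variable {𝔤 : Type u} [LieRing 𝔤] [LieAlgebra ℂ 𝔤]

/-- The elementary relations generating the block equivalence relation on the (isomorphism classes
of) simple finite-dimensional `𝔫`-modules. -/
inductive Linked (𝔫 : LieSubalgebra ℂ 𝔤) : IrrFD.{u, v} 𝔫 → IrrFD.{u, v} 𝔫 → Prop
  | iso (S T : IrrFD.{u, v} 𝔫) (e : S.1.carrier ≃ₗ⁅ℂ,𝔫⁆ T.1.carrier) : Linked 𝔫 S T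
  | indec (S T : IrrFD.{u, v} 𝔫) (M : FDLieMod.{u, v} 𝔫)
      (hM : IsIndecomposable (L := 𝔫) M.carrier)
      (hS : HasFactor (L := 𝔫) M.carrier S.1.carrier)
      (hT : HasFactor (L := 𝔫) M.carrier T.1.carrier) : Linked 𝔫 S T
  | tensor (S T : IrrFD.{u, v} 𝔫)
      (h : HasFactor (L := 𝔫) ((𝔤 ⧸ 𝔫.toLieSubmodule) ⊗[ℂ] S.1.carrier) T.1.carrier) :
      Linked 𝔫 S T

/-- The block equivalence relation on simple finite-dimensional `𝔫`-modules. -/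
def BlockRel (𝔫 : LieSubalgebra ℂ 𝔤) : IrrFD.{u, v} 𝔫 → IrrFD.{u, v} 𝔫 → Prop :=
  Relation.EqvGen (Linked 𝔫)

/-- `S` lies in the block equivalence class of the one-dimensional module given by the
character `χ` of `𝔫`. -/
def InClass (𝔫 : LieSubalgebra ℂ 𝔤) (χ : LieAlgebra.LieCharacter ℂ 𝔫) (S : IrrFD.{u, v} 𝔫) :
    Prop :=
  ∃ T : IrrFD.{u, v} 𝔫, IsCharModule χ T.1.carrier ∧ BlockRel 𝔫 T S

attribute [local instance] LieRing.ofAssociativeRing in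
/-- The algebra homomorphism `U(𝔫) → U(𝔤)` induced by the inclusion. -/
noncomputable def envIncl (𝔫 : LieSubalgebra ℂ 𝔤) :
    UniversalEnvelopingAlgebra ℂ 𝔫 →ₐ[ℂ] UniversalEnvelopingAlgebra ℂ 𝔤 :=
  UniversalEnvelopingAlgebra.lift ℂ ((UniversalEnvelopingAlgebra.ι ℂ).comp 𝔫.incl)

/-- The relations `u x ⊗ m = u ⊗ x m` (for `u ∈ U(𝔤)`, `x ∈ 𝔫`, `m ∈ N`) that turn
`U(𝔤) ⊗_ℂ N` into `U(𝔤) ⊗_{U(𝔫)} N`. -/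
noncomputable def indRel (𝔫 : LieSubalgebra ℂ 𝔤) (N : Type v) [AddCommGroup N] [Module ℂ N]
    [LieRingModule 𝔫 N] :
    Submodule (UniversalEnvelopingAlgebra ℂ 𝔤) (UniversalEnvelopingAlgebra ℂ 𝔤 ⊗[ℂ] N) :=
  Submodule.span _
    {t | ∃ (y : UniversalEnvelopingAlgebra ℂ 𝔤) (x : 𝔫) (m : N),
      t = (y * UniversalEnvelopingAlgebra.ι ℂ (x : 𝔤)) ⊗ₜ[ℂ] m - y ⊗ₜ[ℂ] ⁅x, m⁆}

/-- The induced module `Ind N = U(𝔤) ⊗_{U(𝔫)} N`. -/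
abbrev Ind (𝔫 : LieSubalgebra ℂ 𝔤) (N : Type v) [AddCommGroup N] [Module ℂ N]
    [LieRingModule 𝔫 N] :=
  (UniversalEnvelopingAlgebra ℂ 𝔤 ⊗[ℂ] N) ⧸ indRel 𝔫 N

/-- The category of `𝔤`-modules, as modules over `U(𝔤)`. -/
abbrev GMod (𝔤 : Type u) [LieRing 𝔤] [LieAlgebra ℂ 𝔤] :=
  ModuleCat.{v} (UniversalEnvelopingAlgebra ℂ 𝔤)

/-- The subspace `U(𝔫) m` of a `𝔤`-module. -/
noncomputable def orbit (𝔫 : LieSubalgebra ℂ 𝔤) (M : GMod.{u, v} 𝔤) (m : M) : Submodule ℂ M :=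
  LinearMap.range
    (((LinearMap.toSpanSingleton (UniversalEnvelopingAlgebra ℂ 𝔤) M m).restrictScalars ℂ) ∘ₗ
      (envIncl 𝔫).toLinearMap)

/-- The category `𝔚` of `𝔤`-modules on which the action of `𝔫` is locally finite. -/
def locallyFinite (𝔫 : LieSubalgebra ℂ 𝔤) : ObjectProperty (GMod.{u, v} 𝔤) :=
  fun M => ∀ m : M, Module.Finite ℂ (orbit 𝔫 M m)

/-- The trace in `M` of all modules `Ind N`, where `N` is a finite-dimensional `𝔫`-module all of
whose simple subquotients lie in the class of `χ`. -/
noncomputable def blockTrace (𝔫 : LieSubalgebra ℂ 𝔤) (χ : LieAlgebra.LieCharacter ℂ 𝔫)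
    (M : GMod.{u, v} 𝔤) : Submodule (UniversalEnvelopingAlgebra ℂ 𝔤) M :=
  ⨆ (N : FDLieMod.{u, v} 𝔫)
    (_ : ∀ S : IrrFD.{u, v} 𝔫,
      HasFactor (L := 𝔫) N.carrier S.1.carrier → InClass.{u, v} 𝔫 χ S)
    (f : Ind 𝔫 N.carrier →ₗ[UniversalEnvelopingAlgebra ℂ 𝔤] M), LinearMap.range f

/-- The block `𝔚(χ)`. -/
def block (𝔫 : LieSubalgebra ℂ 𝔤) (χ : LieAlgebra.LieCharacter ℂ 𝔫) :
    ObjectProperty (GMod.{u, v} 𝔤) :=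
  fun M => locallyFinite 𝔫 M ∧ blockTrace 𝔫 χ M = ⊤

/-- The modules of finite length in the block `𝔚(χ)`. -/
def finBlock (𝔫 : LieSubalgebra ℂ 𝔤) (χ : LieAlgebra.LieCharacter ℂ 𝔫) :
    ObjectProperty (GMod.{u, v} 𝔤) :=
  fun M => block 𝔫 χ M ∧ IsFiniteLength (UniversalEnvelopingAlgebra ℂ 𝔤) M

end Blocks

/-! ### The decomposition over `ℂ / ℤ` -/

section Summands

variable {𝔤 : Type u} [LieRing 𝔤] [LieAlgebra ℂ 𝔤]

/-- `X` is (isomorphic to) the one-dimensional `𝔤`-module `L(μ)`, on which `b` acts by `0` and `a`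
acts by `μ`. -/
def IsL (a b : 𝔤) (μ : ℂ) (X : Type v) [AddCommGroup X] [Module ℂ X]
    [Module (UniversalEnvelopingAlgebra ℂ 𝔤) X] : Prop :=
  Module.finrank ℂ X = 1 ∧ ∀ x : X,
    UniversalEnvelopingAlgebra.ι ℂ b • x = 0 ∧ UniversalEnvelopingAlgebra.ι ℂ a • x = μ • x

/-- The group `ℂ / ℤ`. -/
abbrev CModZ := ℂ ⧸ AddSubgroup.zmultiples (1 : ℂ)

/-- The modules in the finite-length block `𝔚(χ)` all of whose simple subquotients are of the form
`L(μ)` with `μ ∈ ξ`. -/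
def finBlockAt (𝔫 : LieSubalgebra ℂ 𝔤) (χ : LieAlgebra.LieCharacter ℂ 𝔫) (a b : 𝔤) (ξ : CModZ) :
    ObjectProperty (GMod.{u, v} 𝔤) :=
  fun M => finBlock 𝔫 χ M ∧
    ∀ p q : Submodule (UniversalEnvelopingAlgebra ℂ 𝔤) M, p ≤ q →
      IsSimpleModule (UniversalEnvelopingAlgebra ℂ 𝔤) (q ⧸ p.comap q.subtype) →
      ∃ μ : ℂ, (μ : CModZ) = ξ ∧ IsL a b μ (q ⧸ p.comap q.subtype)

theorem finBlockAt_le (𝔫 : LieSubalgebra ℂ 𝔤) (χ : LieAlgebra.LieCharacter ℂ 𝔫) (a b : 𝔤)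
    (ξ : CModZ) : finBlockAt.{u, v} 𝔫 χ a b ξ ≤ finBlock 𝔫 χ :=
  fun _ h => h.1

end Summands

/-- The direct sum `⨁ i, C i` of categories: families of objects almost all of which are zero. -/
abbrev DirectSumCat {ι : Type*} (C : ι → Type*) [∀ i, Category (C i)] :=
  ObjectProperty.FullSubcategory (fun X : ∀ i, C i => {i | ¬ IsZero (X i)}.Finite)

/-- The `i`-th component functor of a direct sum of categories. -/
abbrev DirectSumCat.proj {ι : Type*} (C : ι → Type*) [∀ i, Category (C i)] (i : ι) :
    DirectSumCat C ⥤ C i :=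
  ObjectProperty.ι _ ⋙ Pi.eval C i

/-! ### Modules over the quiver -/

/-- A module over the quiver with vertices `i ∈ ℤ`, loops `a i : i → i` and arrows
`b i : i → i + 1`, subject to the relations `b i * a i = a (i + 1) * b i`. -/
structure QuiverMod where
  V : ℤ → Type v
  [addCommGroup : ∀ i, AddCommGroup (V i)]
  [module : ∀ i, Module ℂ (V i)]
  a : ∀ i, V i →ₗ[ℂ] V i
  b : ∀ i, V i →ₗ[ℂ] V (i + 1)
  comm : ∀ i, b i ∘ₗ a i = a (i + 1) ∘ₗ b i

namespace QuiverMod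

attribute [instance] QuiverMod.addCommGroup QuiverMod.module

/-- The space of homomorphisms: families of linear maps that commute with the arrows. -/
def homs (X Y : QuiverMod.{v}) : Submodule ℂ (∀ i, X.V i →ₗ[ℂ] Y.V i) where
  carrier := {f | (∀ i, f i ∘ₗ X.a i = Y.a i ∘ₗ f i) ∧ ∀ i, f (i + 1) ∘ₗ X.b i = Y.b i ∘ₗ f i}
  add_mem' {f g} hf hg :=
    ⟨fun i => by simp [LinearMap.add_comp, LinearMap.comp_add, hf.1 i, hg.1 i],
      fun i => by simp [LinearMap.add_comp, LinearMap.comp_add, hf.2 i, hg.2 i]⟩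
  zero_mem' := ⟨fun i => by simp, fun i => by simp⟩
  smul_mem' c {f} hf :=
    ⟨fun i => by simp [LinearMap.smul_comp, LinearMap.comp_smul, hf.1 i],
      fun i => by simp [LinearMap.smul_comp, LinearMap.comp_smul, hf.2 i]⟩

instance : Category QuiverMod.{v} where
  Hom X Y := homs X Y
  id X := ⟨fun _ => LinearMap.id, fun _ => rfl, fun _ => rfl⟩
  comp f g := ⟨fun i => g.1 i ∘ₗ f.1 i,
    fun i => by
      rw [LinearMap.comp_assoc, f.2.1 i, ← LinearMap.comp_assoc, g.2.1 i, LinearMap.comp_assoc],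
    fun i => by
      rw [LinearMap.comp_assoc, f.2.2 i, ← LinearMap.comp_assoc, g.2.2 i, LinearMap.comp_assoc]⟩

instance : Preadditive QuiverMod.{v} where
  homGroup X Y := inferInstanceAs (AddCommGroup (homs X Y))
  add_comp _ _ _ _ _ _ := Subtype.ext (funext fun _ => LinearMap.comp_add _ _ _)
  comp_add _ _ _ _ _ _ := Subtype.ext (funext fun _ => LinearMap.add_comp _ _ _)

instance : Linear ℂ QuiverMod.{v} where
  homModule X Y := inferInstanceAs (Module ℂ (homs X Y))
  smul_comp _ _ _ _ _ _ := Subtype.ext (funext fun _ => LinearMap.comp_smul _ _ _)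
  comp_smul _ _ _ _ _ _ := Subtype.ext (funext fun _ => LinearMap.smul_comp _ _ _)

/-- The module is finite dimensional (its total space `⨁ i, V i` is), and every `a i` acts locally
nilpotently. -/
def finNilp : ObjectProperty QuiverMod.{v} :=
  fun X => ((∀ i, Module.Finite ℂ (X.V i)) ∧ {i | Nontrivial (X.V i)}.Finite) ∧
    ∀ i (x : X.V i), ∃ k : ℕ, (X.a i ^ k) x = 0

end QuiverMod

end Whittaker

namespace Whittaker

/-! ### Modules over a one-dimensional Lie algebra -/

/-! Everything reduces to the linear algebra of finite-dimensional modules.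

The property "`b` acts by zero" of a simple `𝔫`-module is invariant under each elementary relation
(`Linked.lie_eq_zero_iff`): by Fitting's lemma `b` is either nilpotent or bijective on an
indecomposable finite-dimensional module, and `b` kills `𝔤 ⧸ 𝔫`, so tensoring with it brings in no
new eigenvalue. Hence the modules `N` admitted in the block of zero are those on which `b` is
nilpotent. Since `ab = b(a + 1)`, the vectors killed by a power of `b` form a `𝔤`-submodule, so `b`
is locally nilpotent on every object of the block. A simple module with this property is some
`L(μ)`, so finite length forces finite dimension. Conversely, on a finite-dimensional module `b`
moves the generalized `μ`-eigenspace of `a` into that of `μ + 1`; there are finitely many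
eigenvalues, so `b` is nilpotent and the module is a quotient of the module induced from its own
restriction. This gives `finBlock_iff_finite`. In the same way the summand at `ξ` is the condition
that all eigenvalues of `a` lie in `ξ` (`finBlockAt_iff`).

Both assertions are now read off the generalized eigenspaces of `a`. Those belonging to one coset of
`ℤ` add up to a submodule, a module is the direct sum of these submodules, and homomorphisms
preserve generalized eigenspaces, so different cosets do not interact: this is (i). For (ii), fix `μ
∈ ξ` and put the generalized eigenspace for `μ + i` at vertex `i`, with loop `a - (μ + i)` and arrow
`b`; the bracket `[a, b] = b` becomes commutation with the loops. The functor `totalFunctor` goes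
the other way, letting `a` act on the total space at vertex `i` by the loop plus the scalar `μ + i`.
-/

theorem lieModuleEquiv_map_lie {L : Type u} [LieRing L] {M : Type v} [AddCommGroup M] [Module ℂ M]
    [LieRingModule L M] {S : Type w} [AddCommGroup S] [Module ℂ S] [LieRingModule L S]
    (e : M ≃ₗ⁅ℂ,L⁆ S) (x : L) (m : M) : e ⁅x, m⁆ = ⁅x, e m⁆ :=
  e.toLieModuleHom.map_lie x m

theorem lieModuleEquiv_map_zero {L : Type u} [LieRing L] {M : Type v} [AddCommGroup M] [Module ℂ M]
    [LieRingModule L M] {S : Type w} [AddCommGroup S] [Module ℂ S] [LieRingModule L S]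
    (e : M ≃ₗ⁅ℂ,L⁆ S) : e 0 = 0 :=
  e.toLieModuleHom.map_zero

theorem nontrivial_of_isIrreducible {L : Type u} [LieRing L] {S : Type w} [AddCommGroup S]
    [Module ℂ S] [LieRingModule L S] (hS : LieModule.IsIrreducible ℂ L S) : Nontrivial S :=
  (LieSubmodule.nontrivial_iff ℂ L S).1 inferInstance

/-- The maximal generalized eigenspace is zero away from the eigenvalues. -/
theorem maxGenEigenspace_eq_bot_of_not_hasEigenvalue {V : Type w} [AddCommGroup V] [Module ℂ V]
    {f : Module.End ℂ V} {μ : ℂ} (h : ¬ f.HasEigenvalue μ) : f.maxGenEigenspace μ = ⊥ := by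
  by_contra hb
  have hb' : f.HasUnifEigenvalue μ ⊤ := hb
  exact h (hb'.lt zero_lt_one)

section OneDim

variable {L : Type u} [LieRing L] [LieAlgebra ℂ L]
variable {M : Type v} [AddCommGroup M] [Module ℂ M] [LieRingModule L M] [LieModule ℂ L M]
variable {S : Type w} [AddCommGroup S] [Module ℂ S] [LieRingModule L S] [LieModule ℂ L S]

/-- A subspace stable under a spanning element of `L`, as a Lie submodule. -/
def lieSubmoduleOfStable {x : L} (hx : ∀ y : L, ∃ c : ℂ, y = c • x) (W : Submodule ℂ M)
    (hW : ∀ m ∈ W, ⁅x, m⁆ ∈ W) : LieSubmodule ℂ L M where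
  toSubmodule := W
  lie_mem {y m} hm := by
    obtain ⟨c, rfl⟩ := hx y
    rw [smul_lie]
    exact W.smul_mem c (hW m hm)

/-- By finite dimension, `x` is also surjective on each submodule `q`, hence on each quotient of
`q`, and a surjective operator on a nonzero space is not zero. -/
theorem HasFactor.not_lie_eq_zero [Module.Finite ℂ M] [Nontrivial S] {x : L}
    (hinj : Function.Injective (LieModule.toEnd ℂ L M x)) (h : HasFactor (L := L) M S) :
    ¬ ∀ s : S, ⁅x, s⁆ = 0 := by
  intro hz
  obtain ⟨p, q, -, ⟨e⟩⟩ := h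
  have hsurj : Function.Surjective (LieModule.toEnd ℂ L q x) := by
    have : Module.Finite ℂ q := inferInstanceAs (Module.Finite ℂ q.toSubmodule)
    refine LinearMap.injective_iff_surjective.1 fun m m' hm => ?_
    exact Subtype.ext (hinj (congrArg Subtype.val hm))
  obtain ⟨s, hs⟩ := exists_ne (0 : S)
  obtain ⟨m, hm⟩ := LieSubmodule.Quotient.surjective_mk' (p.comap q.incl) (e.symm s)
  obtain ⟨m', rfl⟩ := hsurj m
  apply hs
  rw [← e.apply_symm_apply s, ← hm]
  simp only [LieModule.toEnd_apply_apply, LieModuleHom.map_lie, lieModuleEquiv_map_lie]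
  exact hz _

theorem HasFactor.exists_pow_eq_zero {x : L}
    (hnil : ∀ m : M, ∃ k : ℕ, (LieModule.toEnd ℂ L M x ^ k) m = 0) (h : HasFactor (L := L) M S)
    (s : S) : ∃ k : ℕ, (LieModule.toEnd ℂ L S x ^ k) s = 0 := by
  obtain ⟨p, q, -, ⟨e⟩⟩ := h
  obtain ⟨m, hm⟩ := LieSubmodule.Quotient.surjective_mk' (p.comap q.incl) (e.symm s)
  obtain ⟨k, hk⟩ := hnil m
  refine ⟨k, ?_⟩
  have h1 : ∀ (k : ℕ) (m : q),
      (LieModule.toEnd ℂ L S x ^ k) (e (LieSubmodule.Quotient.mk' (p.comap q.incl) m)) =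
        e (LieSubmodule.Quotient.mk' (p.comap q.incl) ((LieModule.toEnd ℂ L q x ^ k) m)) := by
    intro k
    induction k with
    | zero => intro m; simp
    | succ k ih =>
      intro m
      rw [pow_succ, pow_succ, Module.End.mul_apply, Module.End.mul_apply, ← ih]
      simp only [LieModule.toEnd_apply_apply, LieModuleHom.map_lie, lieModuleEquiv_map_lie]
  have h2 : ∀ (k : ℕ) (m : q), (((LieModule.toEnd ℂ L q x ^ k) m : q) : M) =
      (LieModule.toEnd ℂ L M x ^ k) m := by
    intro k
    induction k with
    | zero => intro m; simp
    | succ k ih =>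
      intro m
      rw [pow_succ, pow_succ, Module.End.mul_apply, Module.End.mul_apply, ih]
      rfl
  rw [← e.apply_symm_apply s, ← hm, h1]
  have : (LieModule.toEnd ℂ L q x ^ k) m = 0 := Subtype.ext ((h2 k m).trans hk)
  rw [this, map_zero, lieModuleEquiv_map_zero]

/-- A locally nilpotent endomorphism of a nonzero module has a nonzero kernel. -/
theorem exists_ne_zero_apply_eq_zero {V : Type w} [AddCommGroup V] [Module ℂ V] [Nontrivial V]
    (f : Module.End ℂ V) (hf : ∀ s : V, ∃ k : ℕ, (f ^ k) s = 0) : ∃ s : V, s ≠ 0 ∧ f s = 0 := by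
  by_contra! h
  obtain ⟨s, hs⟩ := exists_ne (0 : V)
  obtain ⟨k, hk⟩ := hf s
  have : ∀ k : ℕ, (f ^ k) s ≠ 0 := by
    intro k
    induction k with
    | zero => simpa
    | succ k ih => rw [pow_succ', Module.End.mul_apply]; exact h _ ih
  exact this k hk

/-- As `L` is spanned by `x`, the kernel of `x` is a submodule, so it is everything once it is
nonzero. -/
theorem lie_eq_zero_of_isIrreducible {x : L} (hx : ∀ y : L, ∃ c : ℂ, y = c • x)
    (hS : LieModule.IsIrreducible ℂ L S) (h : ∃ s : S, s ≠ 0 ∧ ⁅x, s⁆ = 0) (s : S) :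
    ⁅x, s⁆ = 0 := by
  obtain ⟨t, ht, ht0⟩ := h
  let K : LieSubmodule ℂ L S := lieSubmoduleOfStable hx (LinearMap.ker (LieModule.toEnd ℂ L S x))
    fun m hm => by
      rw [LinearMap.mem_ker, LieModule.toEnd_apply_apply] at *
      rw [hm, lie_zero]
  have hK : K = ⊤ := by
    refine (hS.eq_bot_or_eq_top K).resolve_left fun hb => ht ?_
    have : t ∈ K := ht0
    rwa [hb, LieSubmodule.mem_bot] at this
  have : s ∈ K := hK ▸ LieSubmodule.mem_top s
  exact this

theorem HasFactor.lie_eq_zero {x : L} (hx : ∀ y : L, ∃ c : ℂ, y = c • x)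
    (hnil : ∀ m : M, ∃ k : ℕ, (LieModule.toEnd ℂ L M x ^ k) m = 0)
    (hS : LieModule.IsIrreducible ℂ L S) (h : HasFactor (L := L) M S) (s : S) : ⁅x, s⁆ = 0 :=
  have := nontrivial_of_isIrreducible hS
  lie_eq_zero_of_isIrreducible hx hS
    (exists_ne_zero_apply_eq_zero _ (h.exists_pow_eq_zero hnil)) s

/-- Fitting's lemma: `M` splits into the kernel and the range of a high power of `x`.
Indecomposability leaves only one of them, and a factor killed by `x` excludes the case of an
injective `x`. -/
theorem HasFactor.exists_pow_eq_zero_of_isIndecomposable [Module.Finite ℂ M] [Nontrivial S] {x : L}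
    (hx : ∀ y : L, ∃ c : ℂ, y = c • x) (hM : IsIndecomposable (L := L) M)
    (h : HasFactor (L := L) M S) (hS : ∀ s : S, ⁅x, s⁆ = 0) (m : M) :
    ∃ k : ℕ, (LieModule.toEnd ℂ L M x ^ k) m = 0 := by
  set f := LieModule.toEnd ℂ L M x with hf
  obtain ⟨k, hk⟩ := Filter.eventually_atTop.1 f.eventually_isCompl_ker_pow_range_pow
  -- The exponent must be positive, so that a trivial kernel of the power forces a trivial kernel of
  -- `f`.
  have hc := hk (k + 1) (Nat.le_succ k)
  let p : LieSubmodule ℂ L M := lieSubmoduleOfStable hx (LinearMap.ker (f ^ (k + 1))) fun m hm => by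
    change (f ^ (k + 1)) (f m) = 0
    rw [← Module.End.mul_apply, ← pow_succ, pow_succ', Module.End.mul_apply,
      LinearMap.mem_ker.1 hm, map_zero]
  let q : LieSubmodule ℂ L M := lieSubmoduleOfStable hx (LinearMap.range (f ^ (k + 1))) <| by
    rintro _ ⟨m, rfl⟩
    refine ⟨f m, ?_⟩
    rw [← LieModule.toEnd_apply_apply ℂ L M x, ← hf, ← Module.End.mul_apply, ← Module.End.mul_apply,
      ← pow_succ, pow_succ']
  have hpq : IsCompl p q := by
    rw [← LieSubmodule.isCompl_toSubmodule]
    exact hc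
  rcases hM.2 p q hpq with hp | hq
  · refine absurd hS (h.not_lie_eq_zero ?_)
    rw [← LinearMap.ker_eq_bot, eq_bot_iff]
    intro m hm
    have : m ∈ p := by
      change (f ^ (k + 1)) m = 0
      rw [pow_succ, Module.End.mul_apply, LinearMap.mem_ker.1 hm, map_zero]
    rw [hp] at this
    exact this
  · refine ⟨k + 1, ?_⟩
    have : (f ^ (k + 1)) m ∈ q := ⟨m, rfl⟩
    rw [hq] at this
    exact this

end OneDim

/-! ### The equivalence class of the trivial `𝔫`-module -/

section BlockOfZero

variable {𝔤 : Type u} [LieRing 𝔤] [LieAlgebra ℂ 𝔤] {𝔫 : LieSubalgebra ℂ 𝔤} {x : 𝔫}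

/-- The invariant that separates the trivial class from all others. Finite dimension of `𝔤` enters
in the tensor case, where injectivity of `x` must pass to subquotients. -/
theorem Linked.lie_eq_zero_iff [Module.Finite ℂ 𝔤] (hx : ∀ y : 𝔫, ∃ c : ℂ, y = c • x)
    (hid : ∀ y : 𝔤, ⁅(x : 𝔤), y⁆ ∈ 𝔫) {S T : IrrFD.{u, v} 𝔫} (h : Linked 𝔫 S T) :
    (∀ s : S.1.carrier, ⁅x, s⁆ = 0) ↔ ∀ t : T.1.carrier, ⁅x, t⁆ = 0 := by
  have hnS := nontrivial_of_isIrreducible S.2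
  have hnT := nontrivial_of_isIrreducible T.2
  cases h with
  | iso e =>
    refine ⟨fun h t => ?_, fun h s => ?_⟩
    · rw [← e.apply_symm_apply t, ← lieModuleEquiv_map_lie, h, lieModuleEquiv_map_zero]
    · rw [← e.symm_apply_apply s, ← lieModuleEquiv_map_lie, h, lieModuleEquiv_map_zero]
  | indec M hM hS hT =>
    exact ⟨fun h => hT.lie_eq_zero hx (hS.exists_pow_eq_zero_of_isIndecomposable hx hM h) T.2,
      fun h => hS.lie_eq_zero hx (hT.exists_pow_eq_zero_of_isIndecomposable hx hM h) S.2⟩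
  | tensor h =>
    -- Because `[x, 𝔤] ⊆ 𝔫`, the element `x` kills `𝔤 ⧸ 𝔫` and acts on the second tensor factor
    -- only.
    have hact : LieModule.toEnd ℂ 𝔫 ((𝔤 ⧸ 𝔫.toLieSubmodule) ⊗[ℂ] S.1.carrier) x =
        (LieModule.toEnd ℂ 𝔫 S.1.carrier x).lTensor (𝔤 ⧸ 𝔫.toLieSubmodule) := by
      refine TensorProduct.ext' fun g s => ?_
      obtain ⟨g, rfl⟩ := LieSubmodule.Quotient.surjective_mk' 𝔫.toLieSubmodule g
      have : ⁅x, LieSubmodule.Quotient.mk' 𝔫.toLieSubmodule g⁆ = 0 := by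
        rw [← LieModuleHom.map_lie, LieSubmodule.Quotient.mk'_apply,
          LieSubmodule.Quotient.mk_eq_zero']
        exact hid g
      rw [LieModule.toEnd_apply_apply, TensorProduct.LieModule.lie_tmul_right, this,
        TensorProduct.zero_tmul, zero_add, LinearMap.lTensor_tmul, LieModule.toEnd_apply_apply]
    constructor
    · intro hS
      have h0 : LieModule.toEnd ℂ 𝔫 S.1.carrier x = 0 := LinearMap.ext hS
      refine h.lie_eq_zero hx (fun m => ⟨1, ?_⟩) T.2
      rw [pow_one, hact, h0, LinearMap.lTensor_zero, LinearMap.zero_apply]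
    · intro hT
      by_contra hS
      -- A nonzero action on an irreducible module is injective, and it stays injective after
      -- tensoring over a field, so no nonzero factor of the product is killed by `x`.
      have hinj : Function.Injective (LieModule.toEnd ℂ 𝔫 S.1.carrier x) := by
        rw [injective_iff_map_eq_zero]
        intro s hs
        by_contra hs0
        exact hS (lie_eq_zero_of_isIrreducible hx S.2 ⟨s, hs0, hs⟩)
      have hfin : Module.Finite ℂ (𝔤 ⧸ 𝔫.toLieSubmodule) :=
        inferInstanceAs (Module.Finite ℂ (𝔤 ⧸ 𝔫.toLieSubmodule.toSubmodule))
      refine h.not_lie_eq_zero ?_ hT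
      rw [hact]
      exact Module.Flat.lTensor_preserves_injective_linearMap _ hinj

theorem lie_eq_zero_of_inClass [Module.Finite ℂ 𝔤] (hx : ∀ y : 𝔫, ∃ c : ℂ, y = c • x)
    (hid : ∀ y : 𝔤, ⁅(x : 𝔤), y⁆ ∈ 𝔫) {S : IrrFD.{u, v} 𝔫} (h : InClass 𝔫 0 S)
    (s : S.1.carrier) : ⁅x, s⁆ = 0 := by
  obtain ⟨T, hT, hTS⟩ := h
  have key : ∀ S T : IrrFD.{u, v} 𝔫, BlockRel 𝔫 S T →
      ((∀ s : S.1.carrier, ⁅x, s⁆ = 0) ↔ ∀ t : T.1.carrier, ⁅x, t⁆ = 0) := by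
    intro S T h
    induction h with
    | rel _ _ h => exact h.lie_eq_zero_iff hx hid
    | refl _ => exact Iff.rfl
    | symm _ _ _ ih => exact ih.symm
    | trans _ _ _ _ _ ih₁ ih₂ => exact ih₁.trans ih₂
  refine (key T S hTS).1 (fun t => ?_) s
  rw [hT.2 x t]
  simp

/-- With zero action every subspace is a submodule, so an irreducible `S` is a line and serves
itself as the one-dimensional module required. -/
theorem inClass_of_lie_eq_zero (hx : ∀ y : 𝔫, ∃ c : ℂ, y = c • x) {S : IrrFD.{u, v} 𝔫}
    (h : ∀ s : S.1.carrier, ⁅x, s⁆ = 0) : InClass 𝔫 0 S := by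
  have := nontrivial_of_isIrreducible S.2
  have hact : ∀ (y : 𝔫) (s : S.1.carrier), ⁅y, s⁆ = 0 := by
    intro y s
    obtain ⟨c, rfl⟩ := hx y
    rw [smul_lie, h, smul_zero]
  refine ⟨S, ⟨?_, fun y s => ?_⟩, Relation.EqvGen.refl S⟩
  · obtain ⟨s, hs⟩ := exists_ne (0 : S.1.carrier)
    refine finrank_eq_one s hs fun t => ?_
    let W : LieSubmodule ℂ 𝔫 S.1.carrier := lieSubmoduleOfStable hx (Submodule.span ℂ {s})
      fun m _ => by rw [h]; exact zero_mem _
    have hW : W = ⊤ := by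
      refine (S.2.eq_bot_or_eq_top W).resolve_left fun hb => hs ?_
      have : s ∈ W := Submodule.mem_span_singleton_self s
      rwa [hb, LieSubmodule.mem_bot] at this
    have : t ∈ W := hW ▸ LieSubmodule.mem_top t
    exact Submodule.mem_span_singleton.1 this
  · rw [hact]
    simp

/-- A finite-dimensional module all of whose simple subquotients lie in the trivial class is
nilpotent. -/
theorem exists_pow_eq_zero_of_forall_inClass [Module.Finite ℂ 𝔤] (hx : ∀ y : 𝔫, ∃ c : ℂ, y = c • x)
    (hid : ∀ y : 𝔤, ⁅(x : 𝔤), y⁆ ∈ 𝔫) (N : FDLieMod.{u, v} 𝔫)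
    (hN : ∀ S : IrrFD.{u, v} 𝔫, HasFactor (L := 𝔫) N.carrier S.1.carrier → InClass.{u, v} 𝔫 0 S)
    (m : N.carrier) : ∃ k : ℕ, (LieModule.toEnd ℂ 𝔫 N.carrier x ^ k) m = 0 := by
  set f := LieModule.toEnd ℂ 𝔫 N.carrier x with hf
  -- The line through an eigenvector is a simple submodule, hence a factor, and so `x` kills it.
  -- With zero as the only eigenvalue, the generalized eigenspace of zero is the whole space.
  have hev : ∀ μ : ℂ, f.HasEigenvalue μ → μ = 0 := by
    intro μ hμ
    obtain ⟨s, hs⟩ := hμ.exists_hasEigenvector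
    have hfs : ⁅x, s⁆ = μ • s := hs.apply_eq_smul
    let W : LieSubmodule ℂ 𝔫 N.carrier := lieSubmoduleOfStable hx (Submodule.span ℂ {s}) <| by
      intro m hm
      obtain ⟨c, rfl⟩ := Submodule.mem_span_singleton.1 hm
      rw [lie_smul, hfs]
      exact Submodule.smul_mem _ _ (Submodule.smul_mem _ _ (Submodule.mem_span_singleton_self s))
    have hsW : s ∈ W := Submodule.mem_span_singleton_self s
    have hWfin : Module.Finite ℂ W := inferInstanceAs (Module.Finite ℂ W.toSubmodule)
    have hirr : LieModule.IsIrreducible ℂ 𝔫 W := by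
      have : Nontrivial W := ⟨⟨s, hsW⟩, 0, fun h => hs.2 (congrArg Subtype.val h)⟩
      refine LieModule.IsIrreducible.mk fun P hP => ?_
      rw [eq_top_iff]
      rintro ⟨m, hm⟩ -
      obtain ⟨⟨t, ht⟩, htP, ht0⟩ : ∃ t ∈ P, t ≠ 0 := by
        by_contra! h
        exact hP ((LieSubmodule.eq_bot_iff P).2 h)
      obtain ⟨c, rfl⟩ := Submodule.mem_span_singleton.1 ht
      obtain ⟨d, rfl⟩ := Submodule.mem_span_singleton.1 hm
      have hc : c ≠ 0 := by
        rintro rfl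
        exact ht0 (Subtype.ext (zero_smul _ _))
      have : (⟨d • s, hm⟩ : W) = (d / c) • (⟨c • s, ht⟩ : W) := by
        refine Subtype.ext ?_
        change d • s = (d / c) • c • s
        rw [smul_smul, div_mul_cancel₀ _ hc]
      rw [this]
      exact P.smul_mem _ htP
    let S : IrrFD.{u, v} 𝔫 := ⟨⟨W⟩, hirr⟩
    have hfac : HasFactor (L := 𝔫) N.carrier S.1.carrier := by
      have hb : ((⊥ : LieSubmodule ℂ 𝔫 N.carrier).comap W.incl).toSubmodule = ⊥ := by
        rw [eq_bot_iff]
        exact fun m hm => Subtype.ext hm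
      refine ⟨⊥, W, bot_le, ⟨{ Submodule.quotEquivOfEqBot _ hb with map_lie' := ?_ }⟩⟩
      intro y m
      obtain ⟨m, rfl⟩ := LieSubmodule.Quotient.surjective_mk' _ m
      rfl
    have := congrArg Subtype.val (lie_eq_zero_of_inClass hx hid (hN S hfac) ⟨s, hsW⟩)
    have h0 : μ • s = 0 := hfs.symm.trans this
    exact (smul_eq_zero.1 h0).resolve_right hs.2
  have htop := Module.End.iSup_maxGenEigenspace_eq_top f
  have hm : m ∈ f.maxGenEigenspace 0 := by
    have : (⨆ μ, f.maxGenEigenspace μ) ≤ f.maxGenEigenspace 0 := by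
      refine iSup_le fun μ => ?_
      by_cases hμ : f.HasEigenvalue μ
      · rw [hev μ hμ]
      · rw [maxGenEigenspace_eq_bot_of_not_hasEigenvalue hμ]
        exact bot_le
    exact this (htop ▸ Submodule.mem_top)
  obtain ⟨k, hk⟩ := (Module.End.mem_maxGenEigenspace f 0 m).1 hm
  exact ⟨k, by simpa using hk⟩

end BlockOfZero

/-! ### Modules over the enveloping algebra of the two-dimensional Lie algebra -/

section Env

variable {𝔤 : Type u} [LieRing 𝔤] [LieAlgebra ℂ 𝔤]

attribute [local instance] LieRing.ofAssociativeRing in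
/-- The enveloping algebra is generated by the Lie algebra. -/
theorem subalgebra_eq_top_of_ι_mem (S : Subalgebra ℂ (UniversalEnvelopingAlgebra ℂ 𝔤))
    (h : ∀ x : 𝔤, UniversalEnvelopingAlgebra.ι ℂ x ∈ S) : S = ⊤ := by
  let f : 𝔤 →ₗ⁅ℂ⁆ S :=
    { toFun := fun x => ⟨UniversalEnvelopingAlgebra.ι ℂ x, h x⟩
      map_add' := fun x y => Subtype.ext (map_add _ x y)
      map_smul' := fun c x => Subtype.ext (map_smul _ c x)
      map_lie' := fun {x y} => Subtype.ext (LieHom.map_lie _ x y) }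
  -- Lifting into `S` and then including is an endomorphism that fixes the generators, so it is the
  -- identity by the universal property, and each element is its own image in `S`.
  have hf : S.val.comp (UniversalEnvelopingAlgebra.lift ℂ f) = AlgHom.id ℂ _ := by
    apply UniversalEnvelopingAlgebra.hom_ext
    ext x
    simp [f]
  rw [eq_top_iff]
  intro u _
  have := DFunLike.congr_fun hf u
  rw [AlgHom.id_apply] at this
  rw [← this]
  exact (UniversalEnvelopingAlgebra.lift ℂ f u).2

theorem subalgebra_eq_top_of_basis_mem (B : Module.Basis (Fin 2) ℂ 𝔤)
    (S : Subalgebra ℂ (UniversalEnvelopingAlgebra ℂ 𝔤))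
    (h0 : UniversalEnvelopingAlgebra.ι ℂ (B 0) ∈ S)
    (h1 : UniversalEnvelopingAlgebra.ι ℂ (B 1) ∈ S) : S = ⊤ := by
  refine subalgebra_eq_top_of_ι_mem S fun x => ?_
  rw [← B.sum_repr x, Fin.sum_univ_two, map_add, map_smul, map_smul]
  exact S.add_mem (S.smul_mem h0 _) (S.smul_mem h1 _)

variable (M : Type v) [AddCommGroup M] [Module ℂ M] [Module (UniversalEnvelopingAlgebra ℂ 𝔤) M]
  [IsScalarTower ℂ (UniversalEnvelopingAlgebra ℂ 𝔤) M]
variable {N : Type w} [AddCommGroup N] [Module ℂ N] [Module (UniversalEnvelopingAlgebra ℂ 𝔤) N]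
  [IsScalarTower ℂ (UniversalEnvelopingAlgebra ℂ 𝔤) N]

/-- The action of an element of the Lie algebra on a module. -/
noncomputable def act (x : 𝔤) : Module.End ℂ M :=
  Algebra.lsmul ℂ ℂ M (UniversalEnvelopingAlgebra.ι ℂ x)

variable {M}

theorem act_apply (x : 𝔤) (m : M) : act M x m = UniversalEnvelopingAlgebra.ι ℂ x • m := rfl

theorem map_act (f : M →ₗ[UniversalEnvelopingAlgebra ℂ 𝔤] N) (x : 𝔤) (m : M) :
    f (act M x m) = act N x (f m) :=
  f.map_smul _ m

attribute [local instance] LieRing.ofAssociativeRing in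
theorem act_lie (x y : 𝔤) : act M ⁅x, y⁆ = act M x * act M y - act M y * act M x := by
  rw [act, LieHom.map_lie, LieRing.of_associative_ring_bracket, map_sub, map_mul, map_mul]
  rfl

/-- A subspace stable under the basis is a submodule. -/
def submoduleOfStable (B : Module.Basis (Fin 2) ℂ 𝔤) (W : Submodule ℂ M)
    (h0 : ∀ m ∈ W, act M (B 0) m ∈ W) (h1 : ∀ m ∈ W, act M (B 1) m ∈ W) :
    Submodule (UniversalEnvelopingAlgebra ℂ 𝔤) M :=
  { W with
    smul_mem' := by
      -- The elements that preserve `W` form a subalgebra; containing the basis of `𝔤`, it is all of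
      -- the enveloping algebra.
      let S : Subalgebra ℂ (UniversalEnvelopingAlgebra ℂ 𝔤) :=
        { carrier := {y | ∀ m ∈ W, y • m ∈ W}
          mul_mem' := fun {y z} hy hz m hm => by rw [mul_smul]; exact hy _ (hz m hm)
          add_mem' := fun {y z} hy hz m hm => by rw [add_smul]; exact W.add_mem (hy m hm) (hz m hm)
          algebraMap_mem' := fun c m hm => by rw [algebraMap_smul]; exact W.smul_mem c hm }
      have hS : S = ⊤ := subalgebra_eq_top_of_basis_mem B S h0 h1
      intro y m hm
      exact (hS ▸ Algebra.mem_top : y ∈ S) m hm }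

/-- A linear map that commutes with the basis is a homomorphism. -/
def linearMapOfCommute (B : Module.Basis (Fin 2) ℂ 𝔤) (f : M →ₗ[ℂ] N)
    (h0 : ∀ m, f (act M (B 0) m) = act N (B 0) (f m))
    (h1 : ∀ m, f (act M (B 1) m) = act N (B 1) (f m)) :
    M →ₗ[UniversalEnvelopingAlgebra ℂ 𝔤] N :=
  { f with
    map_smul' := by
      let S : Subalgebra ℂ (UniversalEnvelopingAlgebra ℂ 𝔤) :=
        { carrier := {y | ∀ m, f (y • m) = y • f m}
          mul_mem' := fun {y z} hy hz m => by
            change f ((y * z) • m) = (y * z) • f m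
            rw [mul_smul, mul_smul, hy, hz]
          add_mem' := fun {y z} hy hz m => by
            change f ((y + z) • m) = (y + z) • f m
            rw [add_smul, add_smul, map_add, hy, hz]
          algebraMap_mem' := fun c m => by rw [algebraMap_smul, algebraMap_smul, map_smul] }
      have hS : S = ⊤ := subalgebra_eq_top_of_basis_mem B S h0 h1
      intro y m
      exact (hS ▸ Algebra.mem_top : y ∈ S) m }

/-! #### The commutation relation -/

variable {a b : 𝔤}

theorem act_mul_act (hab : ⁅a, b⁆ = b) : act M a * act M b = act M b * act M a + act M b := by
  have := act_lie (M := M) a b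
  rw [hab] at this
  nth_rewrite 3 [this]
  abel

theorem act_act (hab : ⁅a, b⁆ = b) (m : M) :
    act M a (act M b m) = act M b (act M a m) + act M b m :=
  LinearMap.congr_fun (act_mul_act hab) m

/-- This makes the vectors killed by a power of `b` stable under `a`, and shows that `b ^ k` raises
an eigenvalue of `a` by `k`. -/
theorem act_pow_act (hab : ⁅a, b⁆ = b) (k : ℕ) (m : M) :
    (act M b ^ k) (act M a m) = act M a ((act M b ^ k) m) - (k : ℂ) • (act M b ^ k) m := by
  induction k with
  | zero => simp
  | succ k ih =>
    rw [pow_succ', Module.End.mul_apply, Module.End.mul_apply, ih, map_sub, map_smul, act_act hab]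
    push_cast
    module

/-- Iterates `(a - (μ + 1)) b = b (a - μ)`, so that `b` carries generalized eigenvectors for `μ` to
generalized eigenvectors for `μ + 1`. -/
theorem sub_smul_pow_act (hab : ⁅a, b⁆ = b) (μ : ℂ) (k : ℕ) (m : M) :
    ((act M a - (μ + 1) • (1 : Module.End ℂ M)) ^ k) (act M b m) =
      act M b (((act M a - μ • (1 : Module.End ℂ M)) ^ k) m) := by
  induction k generalizing m with
  | zero => simp
  | succ k ih =>
    rw [pow_succ, pow_succ, Module.End.mul_apply, Module.End.mul_apply, ← ih]
    congr 1
    simp only [LinearMap.sub_apply, LinearMap.smul_apply, Module.End.one_apply, act_act hab,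
      map_sub, map_smul]
    module

theorem act_mem_maxGenEigenspace (hab : ⁅a, b⁆ = b) {μ : ℂ} {m : M}
    (hm : m ∈ (act M a).maxGenEigenspace μ) : act M b m ∈ (act M a).maxGenEigenspace (μ + 1) := by
  rw [Module.End.mem_maxGenEigenspace] at *
  obtain ⟨k, hk⟩ := hm
  exact ⟨k, by rw [sub_smul_pow_act hab, hk, map_zero]⟩

theorem act_self_mem_maxGenEigenspace {μ : ℂ} {m : M}
    (hm : m ∈ (act M a).maxGenEigenspace μ) : act M a m ∈ (act M a).maxGenEigenspace μ :=
  Module.End.mapsTo_maxGenEigenspace_of_comm (Commute.refl _) μ hm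

theorem map_mem_maxGenEigenspace (f : M →ₗ[UniversalEnvelopingAlgebra ℂ 𝔤] N) {μ : ℂ} {m : M}
    (hm : m ∈ (act M a).maxGenEigenspace μ) : f m ∈ (act N a).maxGenEigenspace μ := by
  rw [Module.End.mem_maxGenEigenspace] at *
  obtain ⟨k, hk⟩ := hm
  refine ⟨k, ?_⟩
  have key : ∀ (k : ℕ) (m : M), ((act N a - μ • (1 : Module.End ℂ N)) ^ k) (f m) =
      f (((act M a - μ • (1 : Module.End ℂ M)) ^ k) m) := by
    intro k
    induction k with
    | zero => intro m; simp
    | succ k ih =>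
      intro m
      rw [pow_succ, pow_succ, Module.End.mul_apply, Module.End.mul_apply, ← ih]
      congr 1
      simp only [LinearMap.sub_apply, LinearMap.smul_apply, Module.End.one_apply, map_sub, map_act]
      rw [← algebraMap_smul (UniversalEnvelopingAlgebra ℂ 𝔤) μ m, map_smul, algebraMap_smul]
  rw [key, hk, map_zero]

/-- The submodule of vectors killed by a power of `b`. -/
noncomputable def nilSubmodule (B : Module.Basis (Fin 2) ℂ 𝔤) (hB : ⁅B 0, B 1⁆ = B 1) (M : Type v)
    [AddCommGroup M] [Module ℂ M] [Module (UniversalEnvelopingAlgebra ℂ 𝔤) M]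
    [IsScalarTower ℂ (UniversalEnvelopingAlgebra ℂ 𝔤) M] :
    Submodule (UniversalEnvelopingAlgebra ℂ 𝔤) M :=
  submoduleOfStable B ((act M (B 1)).maxGenEigenspace 0)
    (fun m hm => by
      rw [Module.End.mem_maxGenEigenspace] at *
      obtain ⟨k, hk⟩ := hm
      rw [zero_smul, sub_zero] at hk
      exact ⟨k, by rw [zero_smul, sub_zero, act_pow_act hB, hk, map_zero, smul_zero, sub_zero]⟩)
    (fun m hm => act_self_mem_maxGenEigenspace hm)

theorem mem_nilSubmodule (B : Module.Basis (Fin 2) ℂ 𝔤) (hB : ⁅B 0, B 1⁆ = B 1) (m : M) :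
    m ∈ nilSubmodule B hB M ↔ ∃ k : ℕ, (act M (B 1) ^ k) m = 0 := by
  refine (Module.End.mem_maxGenEigenspace _ _ _).trans ?_
  simp

theorem map_act_pow (f : M →ₗ[UniversalEnvelopingAlgebra ℂ 𝔤] N) (x : 𝔤) (k : ℕ) (m : M) :
    f ((act M x ^ k) m) = (act N x ^ k) (f m) := by
  induction k with
  | zero => simp
  | succ k ih => rw [pow_succ', pow_succ', Module.End.mul_apply, Module.End.mul_apply, map_act, ih]

/-- On a simple module on which `b` acts by zero, `a` has an eigenvalue. -/
theorem exists_hasEigenvalue_of_isSimpleModule (B : Module.Basis (Fin 2) ℂ 𝔤)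
    [IsSimpleModule (UniversalEnvelopingAlgebra ℂ 𝔤) M] (hb : ∀ m : M, act M (B 1) m = 0) :
    ∃ μ : ℂ, (act M (B 0)).HasEigenvalue μ := by
  have hst : ∀ W : Submodule ℂ M, (∀ m ∈ W, act M (B 0) m ∈ W) → W ≠ ⊥ → W = ⊤ := by
    intro W hW hne
    have := eq_bot_or_eq_top (submoduleOfStable B W hW fun m _ => by rw [hb]; exact W.zero_mem)
    rcases this with h | h
    · refine absurd ((Submodule.eq_bot_iff W).2 fun m hm => ?_) hne
      exact (Submodule.eq_bot_iff _).1 h m hm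
    · refine eq_top_iff.2 fun m _ => ?_
      have : m ∈ submoduleOfStable B W hW fun m _ => by rw [hb]; exact W.zero_mem := by
        rw [h]; trivial
      exact this
  set A := act M (B 0) with hA
  have hnt : Nontrivial M := IsSimpleModule.nontrivial (UniversalEnvelopingAlgebra ℂ 𝔤) M
  obtain ⟨v, hv⟩ := exists_ne (0 : M)
  by_cases hv0 : A v = 0
  · exact ⟨0, Module.End.hasEigenvalue_of_hasEigenvector (x := v)
      ⟨Module.End.mem_eigenspace_iff.2 (by rw [hv0, zero_smul]), hv⟩⟩
  let ev : Polynomial ℂ →ₗ[ℂ] M :=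
    (LinearMap.applyₗ (A v)) ∘ₗ (Polynomial.aeval A).toLinearMap
  have hev : ∀ p, ev p = Polynomial.aeval A p (A v) := fun _ => rfl
  -- Finite dimension is not yet available. Instead, the cyclic subspace generated by `A v` is
  -- stable and nonzero, so it contains `v`, which yields a polynomial relation `v = p(A) A v`.
  have htop : LinearMap.range ev = ⊤ := by
    refine hst _ ?_ ?_
    · rintro _ ⟨p, rfl⟩
      exact ⟨Polynomial.X * p, by rw [hev, hev, map_mul, Polynomial.aeval_X]; rfl⟩
    · intro h
      refine hv0 ((Submodule.eq_bot_iff _).1 h (A v) ⟨1, ?_⟩)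
      rw [hev, map_one]; rfl
  obtain ⟨p, hp⟩ : v ∈ LinearMap.range ev := htop ▸ Submodule.mem_top
  -- This polynomial annihilates `v` and is nonzero since its value at `0` is `-1`.
  let q : Polynomial ℂ := p * Polynomial.X - 1
  have hq0 : q ≠ 0 := by
    intro h
    have := congrArg (Polynomial.eval 0) h
    simp [q] at this
  have hqv : Polynomial.aeval A q v = 0 := by
    have : Polynomial.aeval A q v = Polynomial.aeval A p (A v) - v := by
      simp [q]
    rw [this, ← hev, hp, sub_self]
  have hnu : ¬ IsUnit
      (Polynomial.aeval A (q.roots.map fun x => Polynomial.X - Polynomial.C x).prod) := by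
    intro hu
    rw [(IsAlgClosed.splits q).eq_prod_roots, map_mul, Polynomial.aeval_C, Module.End.mul_apply,
      Module.algebraMap_end_apply] at hqv
    have h2 := (smul_eq_zero.1 hqv).resolve_left (Polynomial.leadingCoeff_ne_zero.2 hq0)
    exact hv (((Module.End.isUnit_iff _).1 hu).1 (h2.trans (map_zero _).symm))
  obtain ⟨μ, hμ, -⟩ := spectrum.exists_mem_of_not_isUnit_aeval_prod hnu
  -- Some linear factor `A - μ` of `q(A)` is not invertible. Were its kernel zero, its range, being
  -- stable and nonzero, would be everything and `A - μ` would be invertible.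
  refine ⟨μ, fun hbot => hμ ?_⟩
  rw [Module.End.genEigenspace_one] at hbot
  have hinj : LinearMap.ker (A - μ • (1 : Module.End ℂ M)) = ⊥ := hbot
  have hrange : LinearMap.range (A - μ • (1 : Module.End ℂ M)) = ⊤ := by
    refine hst _ ?_ ?_
    · rintro _ ⟨m, rfl⟩
      exact ⟨A m, by simp⟩
    · intro h
      rw [LinearMap.range_eq_bot] at h
      rw [h, LinearMap.ker_zero] at hinj
      exact hv ((Submodule.eq_bot_iff _).1 hinj v trivial)
  change IsUnit (algebraMap ℂ (Module.End ℂ M) μ - A)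
  rw [← neg_sub, IsUnit.neg_iff, Module.End.isUnit_iff, Algebra.algebraMap_eq_smul_one]
  exact ⟨LinearMap.ker_eq_bot.1 hinj, LinearMap.range_eq_top.1 hrange⟩

/-- A simple module on which `b` is locally nilpotent is one of the modules `L(μ)`. -/
theorem exists_isL_of_isSimpleModule (B : Module.Basis (Fin 2) ℂ 𝔤) (hB : ⁅B 0, B 1⁆ = B 1)
    [IsSimpleModule (UniversalEnvelopingAlgebra ℂ 𝔤) M]
    (hnil : ∀ m : M, ∃ k : ℕ, (act M (B 1) ^ k) m = 0) : ∃ μ : ℂ, IsL (B 0) (B 1) μ M := by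
  have hnt : Nontrivial M := IsSimpleModule.nontrivial (UniversalEnvelopingAlgebra ℂ 𝔤) M
  have hb : ∀ m : M, act M (B 1) m = 0 := by
    obtain ⟨v, hv, hv0⟩ := exists_ne_zero_apply_eq_zero _ hnil
    let K := submoduleOfStable B (LinearMap.ker (act M (B 1)))
      (fun m hm => by
        have := act_act hB m
        rw [LinearMap.mem_ker] at *
        rw [hm, map_zero, add_zero] at this
        exact this.symm)
      (fun m hm => by
        rw [LinearMap.mem_ker] at *
        rw [hm, map_zero])
    have hK : K = ⊤ := (eq_bot_or_eq_top K).resolve_left fun h =>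
      hv ((Submodule.eq_bot_iff _).1 h v hv0)
    intro m
    have : m ∈ K := hK ▸ Submodule.mem_top
    exact this
  obtain ⟨μ, hμ⟩ := exists_hasEigenvalue_of_isSimpleModule B hb
  obtain ⟨v, hv⟩ := hμ.exists_hasEigenvector
  let K := submoduleOfStable B (Submodule.span ℂ {v})
    (fun m hm => by
      obtain ⟨c, rfl⟩ := Submodule.mem_span_singleton.1 hm
      rw [map_smul, hv.apply_eq_smul]
      exact Submodule.smul_mem _ _ (Submodule.smul_mem _ _ (Submodule.mem_span_singleton_self v)))
    (fun m hm => by rw [hb]; exact zero_mem _)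
  have hK : K = ⊤ := (eq_bot_or_eq_top K).resolve_left fun h =>
    hv.2 ((Submodule.eq_bot_iff _).1 h v (Submodule.mem_span_singleton_self v))
  have hspan : ∀ m : M, ∃ c : ℂ, c • v = m := by
    intro m
    have : m ∈ K := hK ▸ Submodule.mem_top
    exact Submodule.mem_span_singleton.1 this
  refine ⟨μ, finrank_eq_one v hv.2 hspan, fun m => ⟨hb m, ?_⟩⟩
  obtain ⟨c, rfl⟩ := hspan m
  rw [← act_apply, map_smul, hv.apply_eq_smul, smul_comm]

/-- Each simple quotient is some `L(μ)`, so induction along the composition series adds one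
dimension at a time. The `ℂ`-structure and the nilpotency are quantified after `h` because both vary
with the module in the induction. -/
theorem finite_of_isFiniteLength (B : Module.Basis (Fin 2) ℂ 𝔤) (hB : ⁅B 0, B 1⁆ = B 1)
    (M : Type v) [AddCommGroup M] [Module (UniversalEnvelopingAlgebra ℂ 𝔤) M]
    (h : IsFiniteLength (UniversalEnvelopingAlgebra ℂ 𝔤) M) :
    ∀ [Module ℂ M] [IsScalarTower ℂ (UniversalEnvelopingAlgebra ℂ 𝔤) M],
      (∀ m : M, ∃ k : ℕ, (act M (B 1) ^ k) m = 0) → Module.Finite ℂ M := by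
  induction h with
  | of_subsingleton => intros; infer_instance
  | @of_simple_quotient M _ _ N _ _ ih =>
    intro _ _ hnil
    have h1 : Module.Finite ℂ N := by
      refine ih fun m => ?_
      obtain ⟨k, hk⟩ := hnil m
      exact ⟨k, Subtype.ext ((map_act_pow N.subtype (B 1) k m).trans hk)⟩
    obtain ⟨μ, hμ⟩ := exists_isL_of_isSimpleModule (M := M ⧸ N) B hB <| by
      intro m
      obtain ⟨m, rfl⟩ := N.mkQ_surjective m
      obtain ⟨k, hk⟩ := hnil m
      exact ⟨k, by rw [← map_act_pow, hk, map_zero]⟩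
    have h2 : Module.Finite ℂ (M ⧸ N) := Module.finite_of_finrank_eq_succ hμ.1
    have h3 : Module.Finite ℂ (M ⧸ N.restrictScalars ℂ) := h2
    have h4 : Module.Finite ℂ (N.restrictScalars ℂ) := h1
    exact Module.Finite.of_submodule_quotient (N.restrictScalars ℂ)

theorem isFiniteLength_of_finite [Module.Finite ℂ M] :
    IsFiniteLength (UniversalEnvelopingAlgebra ℂ 𝔤) M := by
  rw [isFiniteLength_iff_isNoetherian_isArtinian]
  exact ⟨isNoetherian_of_tower ℂ inferInstance, isArtinian_of_tower ℂ inferInstance⟩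

/-- On a finite-dimensional module the operator `b` is nilpotent. -/
theorem exists_act_pow_eq_zero [Module.Finite ℂ M] (B : Module.Basis (Fin 2) ℂ 𝔤)
    (hB : ⁅B 0, B 1⁆ = B 1) (m : M) : ∃ k : ℕ, (act M (B 1) ^ k) m = 0 := by
  rw [← mem_nilSubmodule B hB]
  change m ∈ (act M (B 1)).maxGenEigenspace 0
  have hle : (⨆ μ, (act M (B 0)).maxGenEigenspace μ) ≤ (act M (B 1)).maxGenEigenspace 0 := by
    refine iSup_le fun μ m hm => ?_
    have hk : ∀ k : ℕ, (act M (B 1) ^ k) m ∈ (act M (B 0)).maxGenEigenspace (μ + k) := by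
      intro k
      induction k with
      | zero => simpa using hm
      | succ k ih =>
        rw [pow_succ', Module.End.mul_apply]
        push_cast
        rw [← add_assoc]
        exact act_mem_maxGenEigenspace hB ih
    -- The numbers `μ + k` are distinct and there are finitely many eigenvalues, so some `b ^ k m`
    -- lies in a zero generalized eigenspace.
    obtain ⟨k, hkev⟩ : ∃ k : ℕ, ¬ (act M (B 0)).HasEigenvalue (μ + k) := by
      by_contra! h
      have hinj : Function.Injective fun k : ℕ => μ + (k : ℂ) := fun k l hkl =>
        Nat.cast_injective (add_left_cancel hkl)
      exact Set.infinite_of_injective_forall_mem hinj h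
        (Module.End.finite_hasEigenvalue (act M (B 0)))
    have h0 := hk k
    rw [maxGenEigenspace_eq_bot_of_not_hasEigenvalue hkev, Submodule.mem_bot] at h0
    rw [Module.End.mem_maxGenEigenspace]
    exact ⟨k, by simpa using h0⟩
  exact hle (Module.End.iSup_maxGenEigenspace_eq_top (act M (B 0)) ▸ Submodule.mem_top)

end Env

/-! ### The finite-length block consists of the finite-dimensional modules -/

section FinBlock

variable {𝔤 : Type u} [LieRing 𝔤] [LieAlgebra ℂ 𝔤]

section Restrict

variable (𝔫 : LieSubalgebra ℂ 𝔤) (M : Type v) [AddCommGroup M] [Module ℂ M]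
  [Module (UniversalEnvelopingAlgebra ℂ 𝔤) M] [IsScalarTower ℂ (UniversalEnvelopingAlgebra ℂ 𝔤) M]

/-- The restriction of a module over the enveloping algebra to a subalgebra. -/
@[reducible] noncomputable def restrictLieRingModule : LieRingModule 𝔫 M where
  bracket x m := act M (x : 𝔤) m
  add_lie x y m := by
    change act M ((x : 𝔤) + (y : 𝔤)) m = act M (x : 𝔤) m + act M (y : 𝔤) m
    simp only [act_apply, map_add, add_smul]
  lie_add x m n := map_add (act M (x : 𝔤)) m n
  leibniz_lie x y m := by
    change act M (x : 𝔤) (act M (y : 𝔤) m) =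
      act M ⁅(x : 𝔤), (y : 𝔤)⁆ m + act M (y : 𝔤) (act M (x : 𝔤) m)
    rw [act_lie, LinearMap.sub_apply, Module.End.mul_apply, Module.End.mul_apply, sub_add_cancel]

/-- The restriction of a finite-dimensional module to a subalgebra, bundled. -/
noncomputable def restrictFD [Module.Finite ℂ M] : FDLieMod.{u, v} 𝔫 :=
  letI := restrictLieRingModule 𝔫 M
  haveI : LieModule ℂ 𝔫 M :=
    { smul_lie := fun c x m => by
        change act M (c • (x : 𝔤)) m = c • act M (x : 𝔤) m
        simp only [act_apply, map_smul, smul_assoc]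
      lie_smul := fun c x m => map_smul (act M (x : 𝔤)) c m }
  ⟨M⟩

/-- The action map `U(𝔤) ⊗ M → M`. -/
noncomputable def indAction :
    (UniversalEnvelopingAlgebra ℂ 𝔤) ⊗[ℂ] M →ₗ[UniversalEnvelopingAlgebra ℂ 𝔤] M :=
  TensorProduct.AlgebraTensorModule.lift
    (LinearMap.toSpanSingleton (UniversalEnvelopingAlgebra ℂ 𝔤) (M →ₗ[ℂ] M) LinearMap.id)

theorem indAction_tmul (y : UniversalEnvelopingAlgebra ℂ 𝔤) (m : M) :
    indAction M (y ⊗ₜ[ℂ] m) = y • m := rfl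

theorem indRel_le_ker_indAction [Module.Finite ℂ M] :
    indRel 𝔫 (restrictFD 𝔫 M).carrier ≤ LinearMap.ker (indAction (𝔤 := 𝔤) M) := by
  refine Submodule.span_le.2 ?_
  rintro _ ⟨y, x, m, rfl⟩
  exact (map_sub (indAction (𝔤 := 𝔤) M) _ _).trans (sub_eq_zero.2 (mul_smul (β := M) y _ m))

end Restrict

variable {𝔫 : LieSubalgebra ℂ 𝔤} {x : 𝔫}

/-- The restriction of `M` to `𝔫` is itself admissible, and the action map from its induced module
reaches `m` from `1 ⊗ m`. -/
theorem blockTrace_eq_top_of_finite (hx : ∀ y : 𝔫, ∃ c : ℂ, y = c • x) (M : GMod.{u, v} 𝔤)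
    [Module.Finite ℂ M] (hnil : ∀ m : M, ∃ k : ℕ, (act M (x : 𝔤) ^ k) m = 0) :
    blockTrace.{u, v} 𝔫 0 M = ⊤ := by
  have hN : ∀ S : IrrFD.{u, v} 𝔫, HasFactor (L := 𝔫) (restrictFD 𝔫 M).carrier S.1.carrier →
      InClass.{u, v} 𝔫 0 S := fun S hS =>
    inClass_of_lie_eq_zero hx (hS.lie_eq_zero hx hnil S.2)
  let f : Ind 𝔫 (restrictFD 𝔫 M).carrier →ₗ[UniversalEnvelopingAlgebra ℂ 𝔤] M :=
    (indRel 𝔫 (restrictFD 𝔫 M).carrier).liftQ (indAction M) (indRel_le_ker_indAction 𝔫 M)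
  refine eq_top_iff.2 fun m _ => ?_
  have hle : LinearMap.range f ≤ blockTrace.{u, v} 𝔫 0 M :=
    le_iSup_of_le (restrictFD 𝔫 M) (le_iSup_of_le hN (le_iSup_of_le f le_rfl))
  refine hle ⟨Submodule.Quotient.mk (1 ⊗ₜ m), ?_⟩
  exact (indAction_tmul M 1 m).trans (one_smul _ m)

/-- Since `nilSubmodule` is a submodule, only the images of `1 ⊗ n` need checking; there `b` acts
through `x` on `N`, where it is nilpotent. -/
theorem exists_act_pow_eq_zero_of_blockTrace [Module.Finite ℂ 𝔤] (B : Module.Basis (Fin 2) ℂ 𝔤)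
    (hB : ⁅B 0, B 1⁆ = B 1) (hx1 : (x : 𝔤) = B 1) (hx : ∀ y : 𝔫, ∃ c : ℂ, y = c • x)
    (hid : ∀ y : 𝔤, ⁅(x : 𝔤), y⁆ ∈ 𝔫) (M : GMod.{u, v} 𝔤) (h : blockTrace.{u, v} 𝔫 0 M = ⊤)
    (m : M) : ∃ k : ℕ, (act M (B 1) ^ k) m = 0 := by
  rw [← mem_nilSubmodule B hB]
  have hle : blockTrace.{u, v} 𝔫 0 M ≤ nilSubmodule B hB M := by
    refine iSup_le fun N => iSup_le fun hN => iSup_le fun f => ?_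
    rintro _ ⟨t, rfl⟩
    obtain ⟨t, rfl⟩ := (indRel 𝔫 N.carrier).mkQ_surjective t
    induction t with
    | zero => rw [map_zero, map_zero]; exact zero_mem _
    | add s t hs ht => rw [map_add, map_add]; exact add_mem hs ht
    | tmul y n =>
      have h1 : y ⊗ₜ[ℂ] n = y • ((1 : UniversalEnvelopingAlgebra ℂ 𝔤) ⊗ₜ[ℂ] n) := by
        rw [TensorProduct.smul_tmul', smul_eq_mul, mul_one]
      rw [h1, map_smul, map_smul]
      refine Submodule.smul_mem _ _ ?_
      rw [mem_nilSubmodule]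
      let g : N.carrier → M := fun n => f ((indRel 𝔫 N.carrier).mkQ (1 ⊗ₜ n))
      have hg : ∀ n, act M (B 1) (g n) = g ⁅x, n⁆ := by
        intro n
        have h2 : (indRel 𝔫 N.carrier).mkQ (UniversalEnvelopingAlgebra.ι ℂ (x : 𝔤) ⊗ₜ[ℂ] n) =
            (indRel 𝔫 N.carrier).mkQ (1 ⊗ₜ ⁅x, n⁆) := by
          refine (Submodule.Quotient.eq _).2 (Submodule.subset_span ⟨1, x, n, ?_⟩)
          rw [one_mul]
        change _ = f _
        rw [← h2, act_apply, ← map_smul, ← map_smul, TensorProduct.smul_tmul', smul_eq_mul, mul_one,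
          hx1]
      have hgk : ∀ (k : ℕ) n, (act M (B 1) ^ k) (g n) =
          g ((LieModule.toEnd ℂ 𝔫 N.carrier x ^ k) n) := by
        intro k
        induction k with
        | zero => intro n; rfl
        | succ k ih => intro n; rw [pow_succ, pow_succ, Module.End.mul_apply, hg, ih]; rfl
      obtain ⟨k, hk⟩ := exists_pow_eq_zero_of_forall_inClass hx hid N hN n
      refine ⟨k, (hgk k n).trans ?_⟩
      rw [hk]
      change f _ = 0
      rw [TensorProduct.tmul_zero, map_zero, map_zero]
  exact hle (h ▸ Submodule.mem_top)

/-- The finite-length block of zero consists of the finite-dimensional modules. -/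
theorem finBlock_iff_finite (B : Module.Basis (Fin 2) ℂ 𝔤) (hB : ⁅B 0, B 1⁆ = B 1)
    (𝔫 : LieSubalgebra ℂ 𝔤) (h𝔫 : 𝔫.toSubmodule = Submodule.span ℂ {B 1})
    (M : GMod.{u, v} 𝔤) :
    finBlock.{u, v} 𝔫 0 M ↔ Module.Finite ℂ M := by
  have hmem : ∀ y : 𝔤, y ∈ 𝔫 ↔ ∃ c : ℂ, c • B 1 = y := fun y => by
    rw [← LieSubalgebra.mem_toSubmodule, h𝔫, Submodule.mem_span_singleton]
  let x : 𝔫 := ⟨B 1, (hmem _).2 ⟨1, one_smul _ _⟩⟩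
  have hx1 : (x : 𝔤) = B 1 := rfl
  have hx : ∀ y : 𝔫, ∃ c : ℂ, y = c • x := by
    rintro ⟨y, hy⟩
    obtain ⟨c, rfl⟩ := (hmem y).1 hy
    exact ⟨c, rfl⟩
  have hid : ∀ y : 𝔤, ⁅(x : 𝔤), y⁆ ∈ 𝔫 := by
    intro y
    -- Only the `a`-coordinate of `y` contributes to the bracket, with `[b, a] = -b`.
    refine (hmem _).2 ⟨-(B.repr y 0), ?_⟩
    nth_rewrite 2 [← B.sum_repr y]
    rw [hx1, Fin.sum_univ_two, lie_add, lie_smul, lie_smul, lie_self, smul_zero, add_zero,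
      ← lie_skew, hB, smul_neg, neg_smul]
  have hfin : Module.Finite ℂ 𝔤 := Module.Finite.of_basis B
  constructor
  · rintro ⟨⟨-, htr⟩, hlen⟩
    exact finite_of_isFiniteLength B hB M hlen
      (exists_act_pow_eq_zero_of_blockTrace B hB hx1 hx hid M htr)
  · intro hM
    exact ⟨⟨fun m => inferInstance,
      blockTrace_eq_top_of_finite hx M (exists_act_pow_eq_zero B hB)⟩, isFiniteLength_of_finite⟩

/-- The summand at `ξ` consists of the finite-dimensional modules on which all eigenvalues of `a`
lie in `ξ`. -/
theorem finBlockAt_iff (B : Module.Basis (Fin 2) ℂ 𝔤) (hB : ⁅B 0, B 1⁆ = B 1)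
    (𝔫 : LieSubalgebra ℂ 𝔤) (h𝔫 : 𝔫.toSubmodule = Submodule.span ℂ {B 1})
    (ξ : CModZ) (M : GMod.{u, v} 𝔤) :
    finBlockAt.{u, v} 𝔫 0 (B 0) (B 1) ξ M ↔
      Module.Finite ℂ M ∧ ∀ μ : ℂ, (act M (B 0)).HasEigenvalue μ → (μ : CModZ) = ξ := by
  rw [finBlockAt, finBlock_iff_finite B hB 𝔫 h𝔫]
  refine and_congr_right fun hfin => ⟨fun h μ hμ => ?_, fun h p q hpq hsimple => ?_⟩
  · obtain ⟨v, hv⟩ := hμ.exists_hasEigenvector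
    have hk := exists_act_pow_eq_zero B hB v
    have hshift : ∀ k : ℕ, act M (B 0) ((act M (B 1) ^ k) v) = (μ + k) • (act M (B 1) ^ k) v := by
      intro k
      have := act_pow_act hB k v
      rw [hv.apply_eq_smul, map_smul] at this
      rw [add_smul, this, sub_add_cancel]
    classical
    -- The last nonzero vector `b ^ k v` spans a submodule isomorphic to `L(μ + k)`, and `μ + k` has
    -- the same class as `μ`.
    obtain ⟨k, hk1⟩ : ∃ k, Nat.find hk = k + 1 := by
      refine Nat.exists_eq_succ_of_ne_zero fun h0 => hv.2 ?_
      have := Nat.find_spec hk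
      rw [h0] at this
      simpa using this
    have hk0 : (act M (B 1) ^ (k + 1)) v = 0 := hk1 ▸ Nat.find_spec hk
    have hw0 : (act M (B 1) ^ k) v ≠ 0 := Nat.find_min hk (by omega)
    set w := (act M (B 1) ^ k) v with hw
    have hbw : act M (B 1) w = 0 := by
      rw [hw, ← Module.End.mul_apply, ← pow_succ', hk0]
    let q := submoduleOfStable B (Submodule.span ℂ {w})
      (fun m hm => by
        obtain ⟨c, rfl⟩ := Submodule.mem_span_singleton.1 hm
        rw [map_smul, hshift]
        exact Submodule.smul_mem _ _ (Submodule.smul_mem _ _ (Submodule.mem_span_singleton_self w)))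
      (fun m hm => by
        obtain ⟨c, rfl⟩ := Submodule.mem_span_singleton.1 hm
        rw [map_smul, hbw, smul_zero]
        exact zero_mem _)
    have hwq : w ∈ q := Submodule.mem_span_singleton_self w
    let p' : Submodule (UniversalEnvelopingAlgebra ℂ 𝔤) q :=
      (⊥ : Submodule (UniversalEnvelopingAlgebra ℂ 𝔤) M).comap q.subtype
    have hne : p'.mkQ ⟨w, hwq⟩ ≠ 0 := by
      intro h0
      exact hw0 ((Submodule.Quotient.mk_eq_zero _).1 h0)
    have hrank : Module.finrank ℂ (q ⧸ p') = 1 := by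
      refine finrank_eq_one _ hne fun y => ?_
      obtain ⟨⟨y, hy⟩, rfl⟩ := p'.mkQ_surjective y
      obtain ⟨c, rfl⟩ := Submodule.mem_span_singleton.1 hy
      exact ⟨c, rfl⟩
    obtain ⟨ν, hν, hL⟩ := h ⊥ q bot_le
      ((isSimpleModule_iff _ _).2 (is_simple_module_of_finrank_eq_one hrank))
    have h1 := (hL.2 (p'.mkQ ⟨w, hwq⟩)).2
    have h2 : UniversalEnvelopingAlgebra.ι ℂ (B 0) • p'.mkQ ⟨w, hwq⟩ =
        (μ + k) • p'.mkQ ⟨w, hwq⟩ := by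
      have : (UniversalEnvelopingAlgebra.ι ℂ (B 0) • (⟨w, hwq⟩ : q)) = (μ + k) • (⟨w, hwq⟩ : q) :=
        Subtype.ext (hshift k)
      rw [← map_smul, this]
      rfl
    have h3 : ν = μ + k := smul_left_injective ℂ hne (h1.symm.trans h2)
    rw [← hν, h3, QuotientAddGroup.eq]
    exact ⟨k, by simp⟩
  · have hq : Module.Finite ℂ q := inferInstanceAs (Module.Finite ℂ (q.restrictScalars ℂ))
    obtain ⟨μ, hL⟩ := exists_isL_of_isSimpleModule (M := q ⧸ p.comap q.subtype) B hB <| by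
      intro y
      obtain ⟨y, rfl⟩ := (p.comap q.subtype).mkQ_surjective y
      obtain ⟨k, hk⟩ := exists_act_pow_eq_zero B hB y
      exact ⟨k, by rw [← map_act_pow, hk, map_zero]⟩
    refine ⟨μ, ?_, hL⟩
    -- If `μ` were not an eigenvalue on `M`, then `a - μ` would be injective on the
    -- finite-dimensional `q`, hence surjective there and on its quotient, where it is zero.
    by_contra hμ
    have hne : ¬ (act M (B 0)).HasEigenvalue μ := fun hev => hμ (h μ hev)
    have hinj : Function.Injective (act q (B 0) - μ • (1 : Module.End ℂ q)) := by
      rw [injective_iff_map_eq_zero]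
      intro y hy
      by_contra hy0
      refine hne (Module.End.hasEigenvalue_of_hasEigenvector (x := (y : M))
        ⟨Module.End.mem_eigenspace_iff.2 ?_, fun h0 => hy0 (Subtype.ext h0)⟩)
      exact congrArg Subtype.val (sub_eq_zero.1 hy)
    have hsurj := LinearMap.injective_iff_surjective.1 hinj
    have hnt : Nontrivial (q ⧸ p.comap q.subtype) :=
      IsSimpleModule.nontrivial (UniversalEnvelopingAlgebra ℂ 𝔤) _
    obtain ⟨y, hy⟩ := exists_ne (0 : q ⧸ p.comap q.subtype)
    obtain ⟨y, rfl⟩ := (p.comap q.subtype).mkQ_surjective y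
    obtain ⟨z, rfl⟩ := hsurj y
    apply hy
    have h1 := (hL.2 ((p.comap q.subtype).mkQ z)).2
    rw [LinearMap.sub_apply, map_sub, map_act]
    exact sub_eq_zero.2 h1

end FinBlock

/-! ### The decomposition over `ℂ / ℤ` -/

section DirectSumLemmas

open DirectSum

variable {ι : Type w} [DecidableEq ι] {R : Type u} [Ring R] {V : ι → Type v}
  [∀ i, AddCommGroup (V i)] [∀ i, Module R (V i)]

theorem directSum_eq_lof (i : ι) (y : ⨁ i, V i) (h : ∀ j, j ≠ i → y j = 0) :
    y = lof R ι V i (y i) := by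
  refine DFinsupp.ext fun j => ?_
  by_cases hj : j = i
  · subst hj
    exact (DirectSum.lof_apply R j (y j)).symm
  · rw [h j hj]
    exact (DirectSum.of_eq_of_ne i j (y i) hj).symm

/-- The image of a direct sum of finite-dimensional modules, almost all of them zero, is
finite-dimensional. -/
theorem finite_of_surjective_directSum {U : Type u} [Ring U] [Algebra ℂ U] [∀ i, Module U (V i)]
    [∀ i, Module ℂ (V i)] [∀ i, IsScalarTower ℂ U (V i)] {X : Type*} [AddCommGroup X] [Module ℂ X]
    [Module U X] [IsScalarTower ℂ U X] (hV : ∀ i, Module.Finite ℂ (V i))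
    (hS : {i | Nontrivial (V i)}.Finite) (g : (⨁ i, V i) →ₗ[U] X) (hg : Function.Surjective g) :
    Module.Finite ℂ X := by
  let f : ∀ i, V i →ₗ[ℂ] X := fun i => (g ∘ₗ lof U ι V i).restrictScalars ℂ
  have htop : (⨆ i : {i | Nontrivial (V i)}, LinearMap.range (f i)) = ⊤ := by
    refine eq_top_iff.2 fun x _ => ?_
    obtain ⟨y, rfl⟩ := hg x
    induction y using DirectSum.induction_on with
    | zero => rw [map_zero]; exact zero_mem _
    | of i x =>
      by_cases hx : x = 0
      · rw [hx, map_zero, map_zero]; exact zero_mem _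
      · exact Submodule.mem_iSup_of_mem (⟨i, ⟨x, 0, hx⟩⟩ : {i | Nontrivial (V i)}) ⟨x, rfl⟩
    | add x y hx hy => rw [map_add]; exact add_mem (hx trivial) (hy trivial)
  have := hS.to_subtype
  rw [Module.finite_def, ← htop]
  refine Submodule.fg_iSup _ fun i => ?_
  rw [← Module.Finite.iff_fg]
  infer_instance

end DirectSumLemmas

/-- An object of a full subcategory of modules is zero if and only if it is trivial. -/
theorem isZero_fullSubcategory_iff {R : Type u} [Ring R] {P : ObjectProperty (ModuleCat.{v} R)}
    (X : P.FullSubcategory) : IsZero X ↔ Subsingleton X.obj := by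
  constructor
  · intro h
    have h0 := congrArg InducedCategory.Hom.hom
      (h.eq_of_src (𝟙 X) (ObjectProperty.homMk (0 : X.obj ⟶ X.obj)))
    refine subsingleton_of_forall_eq 0 fun m => ?_
    exact congrArg (fun g : X.obj ⟶ X.obj => g.hom m) h0
  · intro h
    have hz := ModuleCat.isZero_of_subsingleton X.obj
    exact ⟨fun Y => ⟨⟨⟨ObjectProperty.homMk (0 : X.obj ⟶ Y.obj)⟩, fun f =>
      ObjectProperty.hom_ext _ (hz.eq_of_src _ _)⟩⟩, fun Y => ⟨⟨⟨ObjectProperty.homMk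
        (0 : Y.obj ⟶ X.obj)⟩, fun f => ObjectProperty.hom_ext _ (hz.eq_of_tgt _ _)⟩⟩⟩

/-! ### Splitting a module by cosets of eigenvalues -/

section Parts

variable {𝔤 : Type u} [LieRing 𝔤] [LieAlgebra ℂ 𝔤] (B : Module.Basis (Fin 2) ℂ 𝔤)
  (hB : ⁅B 0, B 1⁆ = B 1)
variable (M : Type v) [AddCommGroup M] [Module ℂ M] [Module (UniversalEnvelopingAlgebra ℂ 𝔤) M]
  [IsScalarTower ℂ (UniversalEnvelopingAlgebra ℂ 𝔤) M]

/-- The sum of the generalized eigenspaces of `a` for a set of eigenvalues closed under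
translation. -/
noncomputable def genPart (S : Set ℂ) (hS : ∀ μ ∈ S, μ + 1 ∈ S) :
    Submodule (UniversalEnvelopingAlgebra ℂ 𝔤) M :=
  submoduleOfStable B (⨆ μ ∈ S, (act M (B 0)).maxGenEigenspace μ)
    (fun m hm => by
      have : (⨆ μ ∈ S, (act M (B 0)).maxGenEigenspace μ) ≤
          (⨆ μ ∈ S, (act M (B 0)).maxGenEigenspace μ).comap (act M (B 0)) :=
        iSup₂_le fun μ hμ m hm => Submodule.mem_iSup_of_mem μ (Submodule.mem_iSup_of_mem hμ
          (act_self_mem_maxGenEigenspace hm))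
      exact this hm)
    (fun m hm => by
      have : (⨆ μ ∈ S, (act M (B 0)).maxGenEigenspace μ) ≤
          (⨆ μ ∈ S, (act M (B 0)).maxGenEigenspace μ).comap (act M (B 1)) :=
        iSup₂_le fun μ hμ m hm => Submodule.mem_iSup_of_mem (μ + 1) (Submodule.mem_iSup_of_mem
          (hS μ hμ) (act_mem_maxGenEigenspace hB hm))
      exact this hm)

variable {M}

theorem mem_genPart {S : Set ℂ} {hS : ∀ μ ∈ S, μ + 1 ∈ S} {m : M} :
    m ∈ genPart B hB M S hS ↔ m ∈ ⨆ μ ∈ S, (act M (B 0)).maxGenEigenspace μ := Iff.rfl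

theorem genPart_mono {S T : Set ℂ} {hS : ∀ μ ∈ S, μ + 1 ∈ S} {hT : ∀ μ ∈ T, μ + 1 ∈ T}
    (h : S ⊆ T) : genPart B hB M S hS ≤ genPart B hB M T hT := fun _ hm =>
  (biSup_mono h : (⨆ μ ∈ S, (act M (B 0)).maxGenEigenspace μ) ≤ _) hm

theorem disjoint_genPart {S T : Set ℂ} {hS : ∀ μ ∈ S, μ + 1 ∈ S} {hT : ∀ μ ∈ T, μ + 1 ∈ T}
    (h : Disjoint S T) : Disjoint (genPart B hB M S hS) (genPart B hB M T hT) := by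
  have hd := (act M (B 0)).independent_maxGenEigenspace.disjoint_biSup_biSup h
  rw [Submodule.disjoint_def] at *
  exact hd

/-- For `μ ∉ S`, an eigenvector would lie both in the sum over `S` and in the generalized eigenspace
of `μ`, which meet in zero. -/
theorem mem_of_hasEigenvalue_genPart {S : Set ℂ} {hS : ∀ μ ∈ S, μ + 1 ∈ S} {μ : ℂ}
    (h : (act (genPart B hB M S hS) (B 0)).HasEigenvalue μ) : μ ∈ S := by
  by_contra hμ
  obtain ⟨v, hv⟩ := h.exists_hasEigenvector
  have hd := (act M (B 0)).independent_maxGenEigenspace.disjoint_biSup hμ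
  rw [Submodule.disjoint_def] at hd
  refine hv.2 (Subtype.ext (hd v ?_ v.2))
  refine Module.End.eigenspace_le_maxGenEigenspace (Module.End.mem_eigenspace_iff.2 ?_)
  exact congrArg Subtype.val hv.apply_eq_smul

theorem genPart_eq_bot {S : Set ℂ} {hS : ∀ μ ∈ S, μ + 1 ∈ S}
    (h : ∀ μ ∈ S, ¬ (act M (B 0)).HasEigenvalue μ) : genPart B hB M S hS = ⊥ := by
  have : (⨆ μ ∈ S, (act M (B 0)).maxGenEigenspace μ) = ⊥ := by
    refine (iSup₂_eq_bot).2 fun μ hμ => maxGenEigenspace_eq_bot_of_not_hasEigenvalue (h μ hμ)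
  rw [eq_bot_iff]
  intro m hm
  rw [mem_genPart, this] at hm
  exact hm

theorem coe_add_one (μ : ℂ) : ((μ + 1 : ℂ) : CModZ) = (μ : CModZ) := by
  rw [eq_comm, QuotientAddGroup.eq]
  exact ⟨1, by simp⟩

variable (M) in
/-- The sum of the generalized eigenspaces of `a` for the eigenvalues in `ξ`. -/
noncomputable def component (ξ : CModZ) : Submodule (UniversalEnvelopingAlgebra ℂ 𝔤) M :=
  genPart B hB M {μ | (μ : CModZ) = ξ} fun μ hμ => (coe_add_one μ).trans hμ

theorem isInternal_component [DecidableEq CModZ] [Module.Finite ℂ M] :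
    DirectSum.IsInternal (component B hB M) := by
  rw [DirectSum.isInternal_submodule_iff_iSupIndep_and_iSup_eq_top]
  constructor
  · intro ξ
    -- All the other components lie in the part for the complementary set of eigenvalues, which
    -- reduces independence to the disjointness of two sets.
    have hle : (⨆ (η : CModZ) (_ : η ≠ ξ), component B hB M η) ≤
        genPart B hB M {μ | (μ : CModZ) ≠ ξ} (fun μ hμ => (coe_add_one μ).trans_ne hμ) :=
      iSup₂_le fun η hη => genPart_mono B hB fun μ hμ => by
        rw [Set.mem_ofPred_eq] at *
        rwa [hμ]
    refine (disjoint_genPart B hB ?_).mono_right hle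
    exact Set.disjoint_left.2 fun μ h1 h2 => h2 h1
  · refine eq_top_iff.2 fun m _ => ?_
    have hle : (⨆ μ, (act M (B 0)).maxGenEigenspace μ) ≤
        (⨆ ξ, component B hB M ξ).restrictScalars ℂ := by
      refine iSup_le fun μ m hm => ?_
      refine Submodule.mem_iSup_of_mem (p := component B hB M) (μ : CModZ) ?_
      exact Submodule.mem_iSup_of_mem μ (Submodule.mem_iSup_of_mem (rfl : (μ : CModZ) = μ) hm)
    exact hle (Module.End.iSup_maxGenEigenspace_eq_top (act M (B 0)) ▸ Submodule.mem_top)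

/-- Modules without common eigenvalues of `a` have no nonzero homomorphisms. -/
theorem linearMap_eq_zero_of_disjoint [Module.Finite ℂ M] {N : Type w} [AddCommGroup N] [Module ℂ N]
    [Module (UniversalEnvelopingAlgebra ℂ 𝔤) N] [IsScalarTower ℂ (UniversalEnvelopingAlgebra ℂ 𝔤) N]
    (a : 𝔤) (h : ∀ μ, (act M a).HasEigenvalue μ → ¬ (act N a).HasEigenvalue μ)
    (f : M →ₗ[UniversalEnvelopingAlgebra ℂ 𝔤] N) (m : M) : f m = 0 := by
  have hle : (⨆ μ, (act M a).maxGenEigenspace μ) ≤ LinearMap.ker (f.restrictScalars ℂ) := by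
    refine iSup_le fun μ m hm => ?_
    by_cases hμ : (act M a).HasEigenvalue μ
    · have := map_mem_maxGenEigenspace f hm
      rw [maxGenEigenspace_eq_bot_of_not_hasEigenvalue (h μ hμ)] at this
      exact this
    · rw [maxGenEigenspace_eq_bot_of_not_hasEigenvalue hμ, Submodule.mem_bot] at hm
      rw [hm]
      exact zero_mem _
  exact hle (Module.End.iSup_maxGenEigenspace_eq_top (act M a) ▸ Submodule.mem_top)

end Parts

/-! ### The direct sum functor and assertion (i) -/

section SumFunctor

open DirectSum

variable {𝔤 : Type u} [LieRing 𝔤] [LieAlgebra ℂ 𝔤] (B : Module.Basis (Fin 2) ℂ 𝔤)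
  (hB : ⁅B 0, B 1⁆ = B 1) (𝔫 : LieSubalgebra ℂ 𝔤)
  (h𝔫 : 𝔫.toSubmodule = Submodule.span ℂ {B 1})

/-- The summand of the finite-length block of zero at `ξ`. -/
abbrev Summand (ξ : CModZ) :=
  (finBlockAt.{u, v} 𝔫 0 (B 0) (B 1) ξ).FullSubcategory

variable {B 𝔫} in
/-- The direct sum of a family of modules. -/
abbrev sumObj (X : ∀ ξ, Summand.{u, v} B 𝔫 ξ) : GMod.{u, v} 𝔤 :=
  ModuleCat.of (UniversalEnvelopingAlgebra ℂ 𝔤) (⨁ ξ, (X ξ).obj)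

open Classical in
variable {B 𝔫} in
/-- The inclusion of a summand. -/
noncomputable def sumLof (X : ∀ ξ, Summand.{u, v} B 𝔫 ξ) (ξ : CModZ) :
    (X ξ).obj →ₗ[UniversalEnvelopingAlgebra ℂ 𝔤] ⨁ ξ, (X ξ).obj :=
  DirectSum.lof (UniversalEnvelopingAlgebra ℂ 𝔤) CModZ (fun ξ => (X ξ).obj) ξ

theorem finBlock_sumObj (B : Module.Basis (Fin 2) ℂ 𝔤) (hB : ⁅B 0, B 1⁆ = B 1)
    (𝔫 : LieSubalgebra ℂ 𝔤) (h𝔫 : 𝔫.toSubmodule = Submodule.span ℂ {B 1})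
    (X : DirectSumCat (Summand.{u, v} B 𝔫)) :
    finBlock.{u, v} 𝔫 0 (sumObj X.obj) := by
  classical
  rw [finBlock_iff_finite B hB 𝔫 h𝔫]
  refine finite_of_surjective_directSum (V := fun ξ => (X.obj ξ).obj) (fun ξ => ?_) ?_
    (LinearMap.id (R := UniversalEnvelopingAlgebra ℂ 𝔤)) Function.surjective_id
  · exact ((finBlockAt_iff B hB 𝔫 h𝔫 ξ _).1 (X.obj ξ).property).1
  · refine X.property.subset fun ξ hξ => ?_
    change ¬ _
    rw [isZero_fullSubcategory_iff, not_subsingleton_iff_nontrivial]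
    exact hξ

/-- The functor `(M_ξ) ↦ ⨁ M_ξ`. -/
noncomputable def sumFunctor :
    DirectSumCat (Summand.{u, v} B 𝔫) ⥤ (finBlock.{u, v} 𝔫 0).FullSubcategory where
  obj X := ⟨sumObj X.obj, finBlock_sumObj B hB 𝔫 h𝔫 X⟩
  map f := ObjectProperty.homMk (ModuleCat.ofHom (DirectSum.lmap fun ξ => (f.hom ξ).hom.hom))
  map_id X := by
    refine ObjectProperty.hom_ext _ (ModuleCat.hom_ext ?_)
    exact DirectSum.lmap_id
  map_comp f g := by
    refine ObjectProperty.hom_ext _ (ModuleCat.hom_ext ?_)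
    exact DirectSum.lmap_comp _ _

/-- The inclusions of the summands, as a natural transformation. -/
noncomputable def sumInclusion (ξ : CModZ) :
    DirectSumCat.proj (Summand.{u, v} B 𝔫) ξ ⋙
      ObjectProperty.ιOfLE (finBlockAt_le 𝔫 0 (B 0) (B 1) ξ) ⟶ sumFunctor B hB 𝔫 h𝔫 where
  app X := ObjectProperty.homMk (ModuleCat.ofHom (sumLof X.obj ξ))
  naturality X Y f := by
    classical
    refine ObjectProperty.hom_ext _ (ModuleCat.hom_ext (LinearMap.ext fun x => ?_))
    exact (DirectSum.lmap_lof (fun ξ => (f.hom ξ).hom.hom) ξ x).symm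

/-- The direct sum is a coproduct. -/
noncomputable def isColimitSum (X : DirectSumCat (Summand.{u, v} B 𝔫)) :
    IsColimit (Cofan.mk ((sumFunctor B hB 𝔫 h𝔫).obj X)
      fun ξ => (sumInclusion B hB 𝔫 h𝔫 ξ).app X) := by
  classical
  refine Cofan.IsColimit.mk _
    (fun t => ObjectProperty.homMk (ModuleCat.ofHom
      (DirectSum.toModule (UniversalEnvelopingAlgebra ℂ 𝔤) CModZ t.pt.obj
        fun ξ => (t.inj ξ).hom.hom))) (fun t ξ => ?_) (fun t m hm => ?_)
  · refine ObjectProperty.hom_ext _ (ModuleCat.hom_ext (LinearMap.ext fun x => ?_))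
    refine (congrArg _ ?_).trans (DirectSum.toModule_lof (UniversalEnvelopingAlgebra ℂ 𝔤)
      (φ := fun ξ => (t.inj ξ).hom.hom) ξ x)
    rfl
  · refine ObjectProperty.hom_ext _ (ModuleCat.hom_ext (DirectSum.linearMap_ext _ fun ξ =>
      LinearMap.ext fun x => ?_))
    refine Eq.trans ?_ (DirectSum.toModule_lof (UniversalEnvelopingAlgebra ℂ 𝔤)
      (φ := fun ξ => (t.inj ξ).hom.hom) ξ x).symm
    exact congrArg (fun g => g.hom.hom x) (hm ξ)

theorem sumFunctor_faithful : (sumFunctor.{u, v} B hB 𝔫 h𝔫).Faithful where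
  map_injective {X Y} f g h := by
    classical
    refine ObjectProperty.hom_ext _ (funext fun ξ => ObjectProperty.hom_ext _
      (ModuleCat.hom_ext (LinearMap.ext fun x => ?_)))
    have h1 := congrArg (fun g => g.hom.hom (sumLof X.obj ξ x)) h
    have h2 : sumLof Y.obj ξ ((f.hom ξ).hom.hom x) = sumLof Y.obj ξ ((g.hom ξ).hom.hom x) :=
      (DirectSum.lmap_lof (fun ξ => (f.hom ξ).hom.hom) ξ x).symm.trans
        (h1.trans (DirectSum.lmap_lof (fun ξ => (g.hom ξ).hom.hom) ξ x))
    exact DirectSum.of_injective ξ h2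

/-- Homomorphisms between summands at different cosets vanish, so a map of direct sums is diagonal
and is recovered from its diagonal blocks. -/
theorem sumFunctor_full : (sumFunctor.{u, v} B hB 𝔫 h𝔫).Full where
  map_surjective {X Y} g := by
    classical
    let f : ∀ ξ η, (X.obj ξ).obj →ₗ[UniversalEnvelopingAlgebra ℂ 𝔤] (Y.obj η).obj := fun ξ η =>
      DirectSum.component (UniversalEnvelopingAlgebra ℂ 𝔤) CModZ (fun η => (Y.obj η).obj) η ∘ₗ
        g.hom.hom ∘ₗ sumLof X.obj ξ
    have hf : ∀ ξ η, η ≠ ξ → ∀ x, f ξ η x = 0 := by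
      intro ξ η hne x
      obtain ⟨hfin, hX⟩ := (finBlockAt_iff B hB 𝔫 h𝔫 ξ _).1 (X.obj ξ).property
      obtain ⟨-, hY⟩ := (finBlockAt_iff B hB 𝔫 h𝔫 η _).1 (Y.obj η).property
      exact linearMap_eq_zero_of_disjoint (B 0)
        (fun μ h1 h2 => hne ((hY μ h2).symm.trans (hX μ h1))) (f ξ η) x
    refine ⟨ObjectProperty.homMk fun ξ => ObjectProperty.homMk (ModuleCat.ofHom (f ξ ξ)), ?_⟩
    refine ObjectProperty.hom_ext _ (ModuleCat.hom_ext (DirectSum.linearMap_ext _ fun ξ =>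
      LinearMap.ext fun x => ?_))
    refine (DirectSum.lmap_lof (fun ξ => f ξ ξ) ξ x).trans ?_
    exact (directSum_eq_lof (R := UniversalEnvelopingAlgebra ℂ 𝔤) ξ
      (g.hom.hom (sumLof X.obj ξ x)) fun η hη => hf ξ η hη x).symm

theorem sumFunctor_essSurj : (sumFunctor.{u, v} B hB 𝔫 h𝔫).EssSurj where
  mem_essImage M := by
    classical
    have hM : Module.Finite ℂ M.obj := (finBlock_iff_finite B hB 𝔫 h𝔫 _).1 M.property
    let X : ∀ ξ, Summand.{u, v} B 𝔫 ξ := fun ξ =>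
      ⟨ModuleCat.of _ (component B hB M.obj ξ), by
        rw [finBlockAt_iff B hB 𝔫 h𝔫]
        have h1 : Module.Finite ℂ (component B hB M.obj ξ) :=
          inferInstanceAs (Module.Finite ℂ ((component B hB M.obj ξ).restrictScalars ℂ))
        exact ⟨h1, fun μ hμ => mem_of_hasEigenvalue_genPart B hB hμ⟩⟩
    -- A nonzero component needs an eigenvalue of `a` in its coset, and there are finitely many
    -- eigenvalues.
    have hX : {ξ | ¬ IsZero (X ξ)}.Finite := by
      refine ((Module.End.finite_hasEigenvalue (act M.obj (B 0))).image
        (fun μ : ℂ => (μ : CModZ))).subset fun ξ hξ => ?_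
      by_contra hne
      refine hξ ((isZero_fullSubcategory_iff _).2 ?_)
      have : component B hB M.obj ξ = ⊥ :=
        genPart_eq_bot B hB fun μ hμ hev => hne ⟨μ, hev, hμ⟩
      exact (Submodule.subsingleton_iff_eq_bot).2 this
    let e := LinearEquiv.ofBijective (DirectSum.coeLinearMap (component B hB M.obj))
      (isInternal_component B hB (M := M.obj))
    exact ⟨⟨X, hX⟩, ⟨ObjectProperty.isoMk _ e.toModuleIso⟩⟩

theorem exists_sum_equivalence (B : Module.Basis (Fin 2) ℂ 𝔤) (hB : ⁅B 0, B 1⁆ = B 1)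
    (𝔫 : LieSubalgebra ℂ 𝔤) (h𝔫 : 𝔫.toSubmodule = Submodule.span ℂ {B 1}) :
    ∃ (E : DirectSumCat (Summand.{u, v} B 𝔫) ≌ (finBlock.{u, v} 𝔫 0).FullSubcategory)
      (i : ∀ ξ : CModZ,
        DirectSumCat.proj (Summand.{u, v} B 𝔫) ξ ⋙
            ObjectProperty.ιOfLE (finBlockAt_le 𝔫 0 (B 0) (B 1) ξ) ⟶ E.functor),
      ∀ M, Nonempty (IsColimit (Cofan.mk (E.functor.obj M) fun ξ => (i ξ).app M)) := by
  have := sumFunctor_faithful.{u, v} B hB 𝔫 h𝔫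
  have := sumFunctor_full.{u, v} B hB 𝔫 h𝔫
  have := sumFunctor_essSurj.{u, v} B hB 𝔫 h𝔫
  have : (sumFunctor.{u, v} B hB 𝔫 h𝔫).IsEquivalence := { }
  exact ⟨(sumFunctor B hB 𝔫 h𝔫).asEquivalence, sumInclusion B hB 𝔫 h𝔫,
    fun X => ⟨isColimitSum B hB 𝔫 h𝔫 X⟩⟩

end SumFunctor

/-! ### Representations from operators -/

section EnvLift

variable {𝔤 : Type u} [LieRing 𝔤] [LieAlgebra ℂ 𝔤]

attribute [local instance] LieRing.ofAssociativeRing in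
/-- Two operators with `A E - E A = E` define a representation of the enveloping algebra. -/
noncomputable def envLift (B : Module.Basis (Fin 2) ℂ 𝔤) (hB : ⁅B 0, B 1⁆ = B 1) {V : Type v}
    [AddCommGroup V] [Module ℂ V] (A E : Module.End ℂ V) (h : A * E - E * A = E) :
    UniversalEnvelopingAlgebra ℂ 𝔤 →ₐ[ℂ] Module.End ℂ V :=
  UniversalEnvelopingAlgebra.lift ℂ
    { B.constr ℂ ![A, E] with
      map_lie' := by
        intro x y
        change B.constr ℂ ![A, E] ⁅x, y⁆ = ⁅B.constr ℂ ![A, E] x, B.constr ℂ ![A, E] y⁆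
        have hB' : ⁅B 1, B 0⁆ = -B 1 := by rw [← lie_skew, hB]
        have h0 : B.constr ℂ ![A, E] (B 0) = A := by simp
        have h1 : B.constr ℂ ![A, E] (B 1) = E := by simp
        have h' : ⁅A, E⁆ = E := h
        have h'' : ⁅E, A⁆ = -E := by rw [← lie_skew, h']
        rw [← B.sum_repr x, ← B.sum_repr y]
        simp only [Fin.sum_univ_two, lie_add, add_lie, lie_smul, smul_lie, lie_self, hB, hB',
          map_add, map_smul, map_neg, h0, h1, h', h'', smul_zero, map_zero] }

theorem envLift_ι_zero (B : Module.Basis (Fin 2) ℂ 𝔤) (hB : ⁅B 0, B 1⁆ = B 1) {V : Type v}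
    [AddCommGroup V] [Module ℂ V] (A E : Module.End ℂ V) (h : A * E - E * A = E) :
    envLift B hB A E h (UniversalEnvelopingAlgebra.ι ℂ (B 0)) = A := by
  rw [envLift, UniversalEnvelopingAlgebra.lift_ι_apply]
  change B.constr ℂ ![A, E] (B 0) = A
  simp

theorem envLift_ι_one (B : Module.Basis (Fin 2) ℂ 𝔤) (hB : ⁅B 0, B 1⁆ = B 1) {V : Type v}
    [AddCommGroup V] [Module ℂ V] (A E : Module.End ℂ V) (h : A * E - E * A = E) :
    envLift B hB A E h (UniversalEnvelopingAlgebra.ι ℂ (B 1)) = E := by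
  rw [envLift, UniversalEnvelopingAlgebra.lift_ι_apply]
  change B.constr ℂ ![A, E] (B 1) = E
  simp

/-- `finBlockAt_iff` uses the scalar structure restricted from the enveloping algebra; any
compatible structure on `T` equals it. -/
theorem finBlockAt_of_iff (B : Module.Basis (Fin 2) ℂ 𝔤) (hB : ⁅B 0, B 1⁆ = B 1)
    (𝔫 : LieSubalgebra ℂ 𝔤) (h𝔫 : 𝔫.toSubmodule = Submodule.span ℂ {B 1}) (ξ : CModZ)
    (T : Type v) [AddCommGroup T] [inst : Module ℂ T] [Module (UniversalEnvelopingAlgebra ℂ 𝔤) T]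
    [IsScalarTower ℂ (UniversalEnvelopingAlgebra ℂ 𝔤) T] :
    finBlockAt.{u, v} 𝔫 0 (B 0) (B 1) ξ (ModuleCat.of (UniversalEnvelopingAlgebra ℂ 𝔤) T) ↔
      Module.Finite ℂ T ∧ ∀ μ : ℂ, (act T (B 0)).HasEigenvalue μ → (μ : CModZ) = ξ := by
  obtain rfl : inst = Module.restrictScalars ℂ (UniversalEnvelopingAlgebra ℂ 𝔤) T := by
    refine Module.ext' _ _ fun c m => ?_
    exact (algebraMap_smul (UniversalEnvelopingAlgebra ℂ 𝔤) c m).symm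
  exact finBlockAt_iff B hB 𝔫 h𝔫 ξ _

end EnvLift

/-! ### The total space of a quiver module -/

section Total

open DirectSum

variable {𝔤 : Type u} [LieRing 𝔤] [LieAlgebra ℂ 𝔤]

/-- The operator `a` on the total space, with generalized eigenvalue `μ + i` at the vertex `i`. -/
noncomputable def totalA (μ : ℂ) (X : QuiverMod.{v}) : Module.End ℂ (⨁ i, X.V i) :=
  DirectSum.lmap fun i => X.a i + (μ + (i : ℂ)) • LinearMap.id

/-- The operator `b` on the total space. -/
noncomputable def totalB (X : QuiverMod.{v}) : Module.End ℂ (⨁ i, X.V i) :=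
  DirectSum.toModule ℂ ℤ _ fun i => DirectSum.lof ℂ ℤ X.V (i + 1) ∘ₗ X.b i

theorem totalA_lof (μ : ℂ) (X : QuiverMod.{v}) (i : ℤ) (x : X.V i) :
    totalA μ X (lof ℂ ℤ X.V i x) = lof ℂ ℤ X.V i (X.a i x + (μ + (i : ℂ)) • x) :=
  DirectSum.lmap_lof _ i x

theorem totalB_lof (X : QuiverMod.{v}) (i : ℤ) (x : X.V i) :
    totalB X (lof ℂ ℤ X.V i x) = lof ℂ ℤ X.V (i + 1) (X.b i x) :=
  DirectSum.toModule_lof ℂ i x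

theorem totalA_mul_totalB (μ : ℂ) (X : QuiverMod.{v}) :
    totalA μ X * totalB X - totalB X * totalA μ X = totalB X := by
  refine DirectSum.linearMap_ext _ fun i => LinearMap.ext fun x => ?_
  have hcomm : X.b i (X.a i x) = X.a (i + 1) (X.b i x) := LinearMap.congr_fun (X.comm i) x
  simp only [LinearMap.comp_apply, LinearMap.sub_apply, Module.End.mul_apply, totalB_lof,
    totalA_lof, ← map_sub]
  congr 1
  -- The scalar grows from `μ + i` to `μ + i + 1` along the arrow, and this surplus of one is the
  -- bracket `[a, b] = b`.
  rw [map_add, map_smul, hcomm]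
  push_cast
  module

/-- The total space of a quiver module, as a module over the enveloping algebra. -/
def Total (B : Module.Basis (Fin 2) ℂ 𝔤) (_ : ⁅B 0, B 1⁆ = B 1) (_ : ℂ) (X : QuiverMod.{v}) :
    Type v :=
  ⨁ i, X.V i

variable (B : Module.Basis (Fin 2) ℂ 𝔤) (hB : ⁅B 0, B 1⁆ = B 1) (μ : ℂ) (X : QuiverMod.{v})

noncomputable instance : AddCommGroup (Total B hB μ X) :=
  inferInstanceAs (AddCommGroup (⨁ i, X.V i))

noncomputable instance : Module ℂ (Total B hB μ X) :=
  inferInstanceAs (Module ℂ (⨁ i, X.V i))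

/-- The action depends on the basis, the bracket relation and `μ`; `Total` carries them as
parameters so that they can be recovered from the type. -/
noncomputable instance : Module (UniversalEnvelopingAlgebra ℂ 𝔤) (Total B hB μ X) :=
  Module.compHom (⨁ i, X.V i)
    (envLift B hB (totalA μ X) (totalB X) (totalA_mul_totalB μ X)).toRingHom

theorem total_smul_def (y : UniversalEnvelopingAlgebra ℂ 𝔤) (t : Total B hB μ X) :
    y • t = envLift B hB (totalA μ X) (totalB X) (totalA_mul_totalB μ X) y t := rfl

instance : IsScalarTower ℂ (UniversalEnvelopingAlgebra ℂ 𝔤) (Total B hB μ X) where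
  smul_assoc c y t := by
    rw [total_smul_def, total_smul_def, map_smul]
    rfl

theorem act_total_zero : act (Total B hB μ X) (B 0) = totalA μ X :=
  envLift_ι_zero B hB _ _ (totalA_mul_totalB μ X)

theorem act_total_one : act (Total B hB μ X) (B 1) = totalB X :=
  envLift_ι_one B hB _ _ (totalA_mul_totalB μ X)

/-- The inclusion of the space at a vertex into the total space. -/
noncomputable def totalLof (i : ℤ) : X.V i →ₗ[ℂ] Total B hB μ X := lof ℂ ℤ X.V i

theorem act_zero_totalLof (i : ℤ) (x : X.V i) :
    act (Total B hB μ X) (B 0) (totalLof B hB μ X i x) =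
      totalLof B hB μ X i (X.a i x + (μ + (i : ℂ)) • x) := by
  rw [act_total_zero]
  exact totalA_lof μ X i x

theorem act_one_totalLof (i : ℤ) (x : X.V i) :
    act (Total B hB μ X) (B 1) (totalLof B hB μ X i x) = totalLof B hB μ X (i + 1) (X.b i x) := by
  rw [act_total_one]
  exact totalB_lof X i x

/-- The projection of the total space onto the space at a vertex. -/
noncomputable def totalComponent (i : ℤ) : Total B hB μ X →ₗ[ℂ] X.V i :=
  DirectSum.component ℂ ℤ X.V i

theorem totalComponent_act_zero (i : ℤ) (t : Total B hB μ X) :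
    totalComponent B hB μ X i (act (Total B hB μ X) (B 0) t) =
      X.a i (totalComponent B hB μ X i t) + (μ + (i : ℂ)) • totalComponent B hB μ X i t := by
  rw [act_total_zero]
  rfl

theorem totalLof_injective (i : ℤ) : Function.Injective (totalLof B hB μ X i) :=
  DirectSum.of_injective i

variable {B hB μ X}

theorem total_ext {t s : Total B hB μ X}
    (h : ∀ i, totalComponent B hB μ X i t = totalComponent B hB μ X i s) : t = s :=
  DFinsupp.ext h

theorem total_hom_ext {N : Type w} [AddCommGroup N] [Module ℂ N] {f g : Total B hB μ X →ₗ[ℂ] N}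
    (h : ∀ i x, f (totalLof B hB μ X i x) = g (totalLof B hB μ X i x)) : f = g :=
  DirectSum.linearMap_ext _ fun i => LinearMap.ext (h i)

theorem eq_totalLof (i : ℤ) (t : Total B hB μ X)
    (h : ∀ j, j ≠ i → totalComponent B hB μ X j t = 0) :
    t = totalLof B hB μ X i (totalComponent B hB μ X i t) :=
  directSum_eq_lof i t h

theorem totalLof_mem_maxGenEigenspace (hX : QuiverMod.finNilp X) (i : ℤ) (x : X.V i) :
    totalLof B hB μ X i x ∈ (act (Total B hB μ X) (B 0)).maxGenEigenspace (μ + i) := by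
  rw [Module.End.mem_maxGenEigenspace]
  obtain ⟨k, hk⟩ := hX.2 i x
  refine ⟨k, ?_⟩
  have key : ∀ (k : ℕ) (x : X.V i), ((act (Total B hB μ X) (B 0) - (μ + (i : ℂ)) • 1) ^ k)
      (totalLof B hB μ X i x) = totalLof B hB μ X i ((X.a i ^ k) x) := by
    intro k
    induction k with
    | zero => intro x; rfl
    | succ k ih =>
      intro x
      rw [pow_succ, pow_succ, Module.End.mul_apply, Module.End.mul_apply, ← ih]
      congr 1
      rw [LinearMap.sub_apply, LinearMap.smul_apply, Module.End.one_apply, act_zero_totalLof,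
        map_add, map_smul, add_sub_cancel_right]
  rw [key, hk, map_zero]

/-- At vertex `j`, `a - ν` acts as `a_j - (ν - (μ + j))`. The component therefore lies in the
generalized eigenspaces of the nilpotent `a_j` for zero and for a nonzero number, which meet in
zero. -/
theorem totalComponent_eq_zero (hX : QuiverMod.finNilp X) {ν : ℂ} {t : Total B hB μ X}
    (ht : t ∈ (act (Total B hB μ X) (B 0)).maxGenEigenspace ν) {j : ℤ} (hj : μ + j ≠ ν) :
    totalComponent B hB μ X j t = 0 := by
  have h0 : totalComponent B hB μ X j t ∈ Module.End.maxGenEigenspace (X.a j) 0 := by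
    rw [Module.End.mem_maxGenEigenspace, zero_smul, sub_zero]
    exact hX.2 j _
  have h1 : totalComponent B hB μ X j t ∈ Module.End.maxGenEigenspace (X.a j) (ν - (μ + j)) := by
    rw [Module.End.mem_maxGenEigenspace] at *
    obtain ⟨k, hk⟩ := ht
    refine ⟨k, ?_⟩
    have key : ∀ (k : ℕ) (t : Total B hB μ X),
        ((X.a j - (ν - (μ + (j : ℂ))) • 1) ^ k) (totalComponent B hB μ X j t) =
        totalComponent B hB μ X j (((act (Total B hB μ X) (B 0) - ν • 1) ^ k) t) := by
      intro k
      induction k with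
      | zero => intro t; rfl
      | succ k ih =>
        intro t
        rw [pow_succ, pow_succ, Module.End.mul_apply, Module.End.mul_apply, ← ih]
        congr 1
        simp only [LinearMap.sub_apply, LinearMap.smul_apply, Module.End.one_apply, map_sub,
          map_smul, totalComponent_act_zero]
        module
    rw [key, hk, map_zero]
  have hd := (Module.End.independent_maxGenEigenspace (X.a j)).pairwiseDisjoint
    (sub_ne_zero.2 hj.symm).symm
  exact Submodule.disjoint_def.1 hd _ h0 h1

theorem exists_eq_of_hasEigenvalue_total (hX : QuiverMod.finNilp X) {ν : ℂ}
    (hν : (act (Total B hB μ X) (B 0)).HasEigenvalue ν) : ∃ j : ℤ, μ + j = ν := by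
  by_contra! h
  obtain ⟨t, ht⟩ := hν.exists_hasEigenvector
  refine ht.2 (total_ext fun j => ?_)
  rw [map_zero]
  exact totalComponent_eq_zero hX (Module.End.eigenspace_le_maxGenEigenspace ht.1) (h j)

theorem finite_total (hX : QuiverMod.finNilp X) : Module.Finite ℂ (Total B hB μ X) := by
  change Module.Finite ℂ (⨁ i, X.V i)
  exact finite_of_surjective_directSum (U := ℂ) (V := X.V) hX.1.1 hX.1.2
    (LinearMap.id : (⨁ i, X.V i) →ₗ[ℂ] (⨁ i, X.V i)) Function.surjective_id

end Total

/-! ### The equivalence with modules over the quiver -/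

section QuiverEquivalence

open DirectSum

variable {𝔤 : Type u} [LieRing 𝔤] [LieAlgebra ℂ 𝔤] (B : Module.Basis (Fin 2) ℂ 𝔤)
  (hB : ⁅B 0, B 1⁆ = B 1) (𝔫 : LieSubalgebra ℂ 𝔤)
  (h𝔫 : 𝔫.toSubmodule = Submodule.span ℂ {B 1}) (μ : ℂ)

section Map

variable {X Y : QuiverMod.{v}}

/-- The map of total spaces induced by a morphism of quiver modules, as a linear map. -/
noncomputable def totalMapAux (f : QuiverMod.homs X Y) : Total B hB μ X →ₗ[ℂ] Total B hB μ Y :=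
  DirectSum.lmap f.1

theorem totalMapAux_totalLof (f : QuiverMod.homs X Y) (i : ℤ) (x : X.V i) :
    totalMapAux B hB μ f (totalLof B hB μ X i x) = totalLof B hB μ Y i (f.1 i x) :=
  DirectSum.lmap_lof f.1 i x

/-- The map of total spaces induced by a morphism of quiver modules. -/
noncomputable def totalMap (f : QuiverMod.homs X Y) :
    Total B hB μ X →ₗ[UniversalEnvelopingAlgebra ℂ 𝔤] Total B hB μ Y :=
  linearMapOfCommute B (totalMapAux B hB μ f)
    (LinearMap.congr_fun (f := totalMapAux B hB μ f ∘ₗ act _ (B 0))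
      (g := act _ (B 0) ∘ₗ totalMapAux B hB μ f) <| total_hom_ext fun i x => by
        have hc : f.1 i (X.a i x) = Y.a i (f.1 i x) := LinearMap.congr_fun (f.2.1 i) x
        rw [LinearMap.comp_apply, LinearMap.comp_apply, act_zero_totalLof, totalMapAux_totalLof,
          totalMapAux_totalLof, act_zero_totalLof, map_add, map_smul, hc])
    (LinearMap.congr_fun (f := totalMapAux B hB μ f ∘ₗ act _ (B 1))
      (g := act _ (B 1) ∘ₗ totalMapAux B hB μ f) <| total_hom_ext fun i x => by
        have hc : f.1 (i + 1) (X.b i x) = Y.b i (f.1 i x) := LinearMap.congr_fun (f.2.2 i) x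
        rw [LinearMap.comp_apply, LinearMap.comp_apply, act_one_totalLof, totalMapAux_totalLof,
          totalMapAux_totalLof, act_one_totalLof, hc])

theorem totalMap_totalLof (f : QuiverMod.homs X Y) (i : ℤ) (x : X.V i) :
    totalMap B hB μ f (totalLof B hB μ X i x) = totalLof B hB μ Y i (f.1 i x) :=
  totalMapAux_totalLof B hB μ f i x

theorem totalMap_ext {f g : Total B hB μ X →ₗ[UniversalEnvelopingAlgebra ℂ 𝔤] Total B hB μ Y}
    (h : ∀ i x, f (totalLof B hB μ X i x) = g (totalLof B hB μ X i x)) : f = g := by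
  have : f.restrictScalars ℂ = g.restrictScalars ℂ := total_hom_ext h
  exact LinearMap.ext fun t => LinearMap.congr_fun this t

/-- A homomorphism preserves generalized eigenvalues, and distinct vertices carry distinct `μ + i`,
so `g` maps each vertex space to that of the same vertex. -/
theorem exists_totalMap_eq (hX : QuiverMod.finNilp X) (hY : QuiverMod.finNilp Y)
    (g : Total B hB μ X →ₗ[UniversalEnvelopingAlgebra ℂ 𝔤] Total B hB μ Y) :
    ∃ f : QuiverMod.homs X Y, totalMap B hB μ f = g := by
  let f : ∀ i, X.V i →ₗ[ℂ] Y.V i := fun i =>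
    totalComponent B hB μ Y i ∘ₗ g.restrictScalars ℂ ∘ₗ totalLof B hB μ X i
  have hg : ∀ i x, g (totalLof B hB μ X i x) = totalLof B hB μ Y i (f i x) := by
    intro i x
    refine eq_totalLof i _ fun j hj => ?_
    refine totalComponent_eq_zero hY
      (map_mem_maxGenEigenspace g (totalLof_mem_maxGenEigenspace hX i x)) fun h => hj ?_
    exact Int.cast_injective (add_left_cancel h)
  refine ⟨⟨f, fun i => LinearMap.ext fun x => ?_, fun i => LinearMap.ext fun x => ?_⟩,
    totalMap_ext B hB μ fun i x => (totalMap_totalLof B hB μ _ i x).trans (hg i x).symm⟩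
  · apply totalLof_injective B hB μ Y i
    have := map_act g (B 0) (totalLof B hB μ X i x)
    rw [act_zero_totalLof, hg, hg, act_zero_totalLof, map_add, map_smul, map_add, map_add] at this
    -- The scalar term for `μ + i` occurs on both sides; what remains is commutation with the loops.
    exact add_right_cancel this
  · apply totalLof_injective B hB μ Y (i + 1)
    have := map_act g (B 1) (totalLof B hB μ X i x)
    rw [act_one_totalLof, hg, hg, act_one_totalLof] at this
    exact this

end Map

theorem coe_add_int (μ : ℂ) (i : ℤ) : ((μ + i : ℂ) : CModZ) = (μ : CModZ) := by
  rw [eq_comm, QuotientAddGroup.eq]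
  exact ⟨i, by simp⟩

theorem exists_add_int_eq {μ ν : ℂ} (h : (ν : CModZ) = (μ : CModZ)) : ∃ i : ℤ, μ + i = ν := by
  rw [eq_comm, QuotientAddGroup.eq] at h
  obtain ⟨i, hi⟩ := h
  exact ⟨i, by simp at hi; rw [hi]; ring⟩

theorem finBlockAt_total (B : Module.Basis (Fin 2) ℂ 𝔤) (hB : ⁅B 0, B 1⁆ = B 1)
    (𝔫 : LieSubalgebra ℂ 𝔤) (h𝔫 : 𝔫.toSubmodule = Submodule.span ℂ {B 1}) (μ : ℂ)
    {X : QuiverMod.{v}} (hX : QuiverMod.finNilp X) :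
    finBlockAt.{u, v} 𝔫 0 (B 0) (B 1) (μ : CModZ)
      (ModuleCat.of (UniversalEnvelopingAlgebra ℂ 𝔤) (Total B hB μ X)) := by
  rw [finBlockAt_of_iff B hB 𝔫 h𝔫]
  refine ⟨finite_total hX, fun ν hν => ?_⟩
  obtain ⟨j, rfl⟩ := exists_eq_of_hasEigenvalue_total hX hν
  exact coe_add_int μ j

/-- The functor that sends a quiver module to its total space. -/
noncomputable def totalFunctor :
    (QuiverMod.finNilp.{v}).FullSubcategory ⥤ Summand.{u, v} B 𝔫 (μ : CModZ) where
  obj X := ⟨ModuleCat.of _ (Total B hB μ X.obj), finBlockAt_total B hB 𝔫 h𝔫 μ X.property⟩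
  map f := ObjectProperty.homMk (ModuleCat.ofHom (totalMap B hB μ f.hom))
  map_id X := by
    refine ObjectProperty.hom_ext _ (ModuleCat.hom_ext ?_)
    exact totalMap_ext B hB μ fun i x => totalMap_totalLof B hB μ _ i x
  map_comp f g := by
    refine ObjectProperty.hom_ext _ (ModuleCat.hom_ext ?_)
    refine totalMap_ext B hB μ fun i x => (totalMap_totalLof B hB μ _ i x).trans ?_
    refine Eq.trans ?_ (congrArg (totalMap B hB μ g.hom) (totalMap_totalLof B hB μ f.hom i x)).symm
    exact (totalMap_totalLof B hB μ g.hom i _).symm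

theorem totalFunctor_faithful : (totalFunctor.{u, v} B hB 𝔫 h𝔫 μ).Faithful where
  map_injective {X Y} f g h := by
    refine ObjectProperty.hom_ext _ (Subtype.ext (funext fun i => LinearMap.ext fun x => ?_))
    apply totalLof_injective B hB μ Y.obj i
    refine (totalMap_totalLof B hB μ f.hom i x).symm.trans (Eq.trans ?_
      (totalMap_totalLof B hB μ g.hom i x))
    exact congrArg (fun g => g.hom.hom (totalLof B hB μ X.obj i x)) h

theorem totalFunctor_full : (totalFunctor.{u, v} B hB 𝔫 h𝔫 μ).Full where
  map_surjective {X Y} g := by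
    obtain ⟨f, hf⟩ := exists_totalMap_eq B hB μ X.property Y.property g.hom.hom
    exact ⟨ObjectProperty.homMk f, ObjectProperty.hom_ext _ (ModuleCat.hom_ext hf)⟩

theorem totalFunctor_additive : (totalFunctor.{u, v} B hB 𝔫 h𝔫 μ).Additive where
  map_add {X Y f g} := by
    refine ObjectProperty.hom_ext _ (ModuleCat.hom_ext (totalMap_ext B hB μ fun i x => ?_))
    refine (totalMap_totalLof B hB μ _ i x).trans ?_
    refine ((totalLof B hB μ Y.obj i).map_add (f.hom.1 i x) (g.hom.1 i x)).trans ?_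
    exact (congrArg₂ (· + ·) (totalMap_totalLof B hB μ f.hom i x)
      (totalMap_totalLof B hB μ g.hom i x)).symm

theorem totalFunctor_linear : (totalFunctor.{u, v} B hB 𝔫 h𝔫 μ).Linear ℂ where
  map_smul {X Y} f c := by
    refine ObjectProperty.hom_ext _ (ModuleCat.hom_ext (totalMap_ext B hB μ fun i x => ?_))
    refine (totalMap_totalLof B hB μ _ i x).trans ?_
    refine ((totalLof B hB μ Y.obj i).map_smul c (f.hom.1 i x)).trans ?_
    refine (algebraMap_smul (UniversalEnvelopingAlgebra ℂ 𝔤) c _).symm.trans ?_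
    exact (congrArg (algebraMap ℂ (UniversalEnvelopingAlgebra ℂ 𝔤) c • ·)
      (totalMap_totalLof B hB μ f.hom i x)).symm

/-! ### The quiver module of generalized eigenspaces -/

section Eigen

variable (M : Type v) [AddCommGroup M] [Module ℂ M] [Module (UniversalEnvelopingAlgebra ℂ 𝔤) M]
  [IsScalarTower ℂ (UniversalEnvelopingAlgebra ℂ 𝔤) M]

/-- The quiver module of generalized eigenspaces of `a` for the eigenvalues in `μ + ℤ`. -/
noncomputable def eigenQuiver : QuiverMod.{v} where
  V i := (act M (B 0)).maxGenEigenspace (μ + (i : ℂ))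
  a i := (act M (B 0) - (μ + (i : ℂ)) • (1 : Module.End ℂ M)).restrict fun m hm =>
    Submodule.sub_mem _ (act_self_mem_maxGenEigenspace hm) (Submodule.smul_mem _ _ hm)
  b i := (act M (B 1)).restrict fun m hm => by
    have := act_mem_maxGenEigenspace hB hm
    rw [add_assoc] at this
    push_cast
    exact this
  comm i := by
    refine LinearMap.ext fun x => Subtype.ext ?_
    change act M (B 1) (act M (B 0) x - (μ + (i : ℂ)) • (x : M)) =
      act M (B 0) (act M (B 1) x) - (μ + ((i + 1 : ℤ) : ℂ)) • act M (B 1) x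
    rw [act_act hB, map_sub, map_smul]
    push_cast
    module

theorem eigenQuiver_finNilp [Module.Finite ℂ M] : QuiverMod.finNilp (eigenQuiver B hB μ M) := by
  refine ⟨⟨fun i => ?_, ?_⟩, fun i x => ?_⟩
  · change Module.Finite ℂ ((act M (B 0)).maxGenEigenspace (μ + (i : ℂ)))
    infer_instance
  · refine ((Module.End.finite_hasEigenvalue (act M (B 0))).preimage
      (f := fun i : ℤ => μ + (i : ℂ)) fun i _ j _ h =>
        Int.cast_injective (add_left_cancel h)).subset fun i hi => ?_
    by_contra hne
    have hbot := maxGenEigenspace_eq_bot_of_not_hasEigenvalue (f := act M (B 0)) hne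
    have hi' : Nontrivial ((act M (B 0)).maxGenEigenspace (μ + (i : ℂ))) := hi
    rw [hbot] at hi'
    exact not_subsingleton (⊥ : Submodule ℂ M) inferInstance
  · obtain ⟨k, hk⟩ := (Module.End.mem_maxGenEigenspace _ _ _).1 x.2
    refine ⟨k, Subtype.ext ?_⟩
    have key : ∀ (k : ℕ) (x : (eigenQuiver B hB μ M).V i),
        (((eigenQuiver B hB μ M).a i ^ k) x).1 =
          ((act M (B 0) - (μ + (i : ℂ)) • (1 : Module.End ℂ M)) ^ k) x.1 := by
      intro k
      induction k with
      | zero => intro x; rfl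
      | succ k ih =>
        intro x
        rw [pow_succ, pow_succ, Module.End.mul_apply, Module.End.mul_apply, ih]
        rfl
    exact (key k x).trans hk

/-- The map from the total space of the generalized eigenspaces to the module. -/
noncomputable def eigenSumAux : Total B hB μ (eigenQuiver B hB μ M) →ₗ[ℂ] M :=
  DirectSum.coeLinearMap fun i : ℤ => (act M (B 0)).maxGenEigenspace (μ + (i : ℂ))

theorem eigenSumAux_totalLof (i : ℤ) (x : (eigenQuiver B hB μ M).V i) :
    eigenSumAux B hB μ M (totalLof B hB μ _ i x) = x.1 :=
  DirectSum.coeLinearMap_lof (fun i : ℤ => (act M (B 0)).maxGenEigenspace (μ + (i : ℂ))) i x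

/-- The map from the total space of the generalized eigenspaces to the module, as a
homomorphism. -/
noncomputable def eigenSum :
    Total B hB μ (eigenQuiver B hB μ M) →ₗ[UniversalEnvelopingAlgebra ℂ 𝔤] M :=
  linearMapOfCommute B (eigenSumAux B hB μ M)
    (LinearMap.congr_fun (f := eigenSumAux B hB μ M ∘ₗ act _ (B 0))
      (g := act _ (B 0) ∘ₗ eigenSumAux B hB μ M) <| total_hom_ext fun i x => by
        rw [LinearMap.comp_apply, LinearMap.comp_apply, act_zero_totalLof, eigenSumAux_totalLof,
          eigenSumAux_totalLof]
        change act M (B 0) x.1 - (μ + (i : ℂ)) • x.1 + (μ + (i : ℂ)) • x.1 = _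
        rw [sub_add_cancel])
    (LinearMap.congr_fun (f := eigenSumAux B hB μ M ∘ₗ act _ (B 1))
      (g := act _ (B 1) ∘ₗ eigenSumAux B hB μ M) <| total_hom_ext fun i x => by
        rw [LinearMap.comp_apply, LinearMap.comp_apply, act_one_totalLof, eigenSumAux_totalLof,
          eigenSumAux_totalLof]
        rfl)

/-- Generalized eigenspaces for the distinct numbers `μ + i` are independent, and they span because
every eigenvalue has this form. -/
theorem eigenSum_bijective [Module.Finite ℂ M]
    (hev : ∀ ν : ℂ, (act M (B 0)).HasEigenvalue ν → (ν : CModZ) = (μ : CModZ)) :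
    Function.Bijective (eigenSum B hB μ M) := by
  have hint : DirectSum.IsInternal fun i : ℤ => (act M (B 0)).maxGenEigenspace (μ + (i : ℂ)) := by
    rw [DirectSum.isInternal_submodule_iff_iSupIndep_and_iSup_eq_top]
    refine ⟨(Module.End.independent_maxGenEigenspace (act M (B 0))).comp
      fun i j h => Int.cast_injective (add_left_cancel h), ?_⟩
    rw [eq_top_iff, ← Module.End.iSup_maxGenEigenspace_eq_top (act M (B 0))]
    refine iSup_le fun ν => ?_
    by_cases hν : (act M (B 0)).HasEigenvalue ν
    · obtain ⟨i, rfl⟩ := exists_add_int_eq (hev ν hν)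
      exact le_iSup (fun i : ℤ => (act M (B 0)).maxGenEigenspace (μ + (i : ℂ))) i
    · rw [maxGenEigenspace_eq_bot_of_not_hasEigenvalue hν]
      exact bot_le
  exact hint

end Eigen

theorem totalFunctor_essSurj : (totalFunctor.{u, v} B hB 𝔫 h𝔫 μ).EssSurj where
  mem_essImage M := by
    obtain ⟨hfin, hev⟩ := (finBlockAt_iff B hB 𝔫 h𝔫 _ _).1 M.property
    exact ⟨⟨eigenQuiver B hB μ M.obj, eigenQuiver_finNilp B hB μ M.obj⟩,
      ⟨ObjectProperty.isoMk _ (LinearEquiv.ofBijective (eigenSum B hB μ M.obj)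
        (eigenSum_bijective B hB μ M.obj hev)).toModuleIso⟩⟩

/-- A representative `μ` of `ξ` is chosen to fix which eigenvalue sits at vertex `0`. The total
space functor starts from quiver modules, so its inverse is returned and inherits additivity and
linearity. -/
theorem exists_quiver_equivalence (B : Module.Basis (Fin 2) ℂ 𝔤) (hB : ⁅B 0, B 1⁆ = B 1)
    (𝔫 : LieSubalgebra ℂ 𝔤) (h𝔫 : 𝔫.toSubmodule = Submodule.span ℂ {B 1}) (ξ : CModZ) :
    ∃ e : (finBlockAt.{u, v} 𝔫 0 (B 0) (B 1) ξ).FullSubcategory ≌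
        (QuiverMod.finNilp.{v}).FullSubcategory,
      e.functor.Additive ∧ e.functor.Linear ℂ := by
  obtain ⟨μ, rfl⟩ := QuotientAddGroup.mk_surjective ξ
  have := totalFunctor_faithful.{u, v} B hB 𝔫 h𝔫 μ
  have := totalFunctor_full.{u, v} B hB 𝔫 h𝔫 μ
  have := totalFunctor_essSurj.{u, v} B hB 𝔫 h𝔫 μ
  have : (totalFunctor.{u, v} B hB 𝔫 h𝔫 μ).IsEquivalence := { }
  let e := (totalFunctor.{u, v} B hB 𝔫 h𝔫 μ).asEquivalence
  have hadd : e.functor.Additive := totalFunctor_additive.{u, v} B hB 𝔫 h𝔫 μ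
  have hlin : e.functor.Linear ℂ := totalFunctor_linear.{u, v} B hB 𝔫 h𝔫 μ
  exact ⟨e.symm, e.inverse_additive, e.inverseLinear ℂ⟩

end QuiverEquivalence

end Whittaker

open Whittaker in
theorem theorem6003 {𝔤 : Type u} [LieRing 𝔤] [LieAlgebra ℂ 𝔤]
    (B : Module.Basis (Fin 2) ℂ 𝔤) (hB : ⁅B 0, B 1⁆ = B 1)
    (𝔫 : LieSubalgebra ℂ 𝔤) (h𝔫 : 𝔫.toSubmodule = Submodule.span ℂ {B 1}) :
    (∃ (E : DirectSumCat
            (fun ξ : CModZ => (finBlockAt.{u, v} 𝔫 0 (B 0) (B 1) ξ).FullSubcategory) ≌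
          (finBlock.{u, v} 𝔫 0).FullSubcategory)
        (i : ∀ ξ : CModZ,
          DirectSumCat.proj
              (fun ξ : CModZ => (finBlockAt.{u, v} 𝔫 0 (B 0) (B 1) ξ).FullSubcategory) ξ ⋙
            ObjectProperty.ιOfLE (finBlockAt_le 𝔫 0 (B 0) (B 1) ξ) ⟶ E.functor),
        ∀ M, Nonempty (IsColimit (Cofan.mk (E.functor.obj M) fun ξ => (i ξ).app M))) ∧
    ∀ ξ : CModZ,
      ∃ e : (finBlockAt.{u, v} 𝔫 0 (B 0) (B 1) ξ).FullSubcategory ≌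
          (QuiverMod.finNilp.{v}).FullSubcategory,
        e.functor.Additive ∧ e.functor.Linear ℂ :=
  ⟨exists_sum_equivalence B hB 𝔫 h𝔫, exists_quiver_equivalence B hB 𝔫 h𝔫⟩
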